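/- **Model.** Arrays $A$ of $n$ elements over an arbitrary totally ordered set (repetitions allowed) are accessed only through comparisons "$x\le y$?", each comparison being between two array elements or, during a search, also between an array element and the search key. A selection query with rank $s\in\{1,\dots,n\}$ asks for an array element whose value is that of the $s$-th entry of $A$ in sorted order. A search query with key $p$ asks for the position $j$ of (the first occurrence of) $p$ in the sorted array if $p$ occurs in $A$, and for $j=\#\{i: A[i]<p\}$ otherwise; it counts as a query of rank $j$. A deterministic online algorithm may preprocess the array, and then must answer each query before the next one is revealed. For a sequence $Q$ of $q$ queries with ranks $s_1\le\dots\le s_q$ after sorting, put $s_0=0$, $s_{q+1}=n$, $\Delta_i=s_{i+1}-s_i$, and $$\mathcal B(S_q)=\log_2 n!-\sum_{i=0}^{q}\log_2(\Delta_i!).$$ **Theorem (Optimal Online Multiselection).** There are a deterministic online algorithm (a family of comparison decision procedures, one for each $n$), a constant $C$ and a function $\omega:\mathbb R\to[0,1]$ with $\omega(x)\to 0$ as $x\to\infty$ such that the algorithm answers every query of every finite sequence of selection and search queries on every array correctly and, for every $n\ge 2$, every array of $n$ elements and every sequence $Q$ of $q$ queries, $q'$ of which are searches, uses in total (preprocessing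 included) at most $$\mathcal B(S_q)\bigl(1+\omega(\mathcal B(S_q)/n)\bigr)+C\,(n+q'\log_2 n)$$ comparisons; that is, $\mathcal B(S_q)(1+o(1))+O(n+q'\log n)$ comparisons in the worst case. Moreover, $\mathcal B(S_q)$ is a lower bound for offline algorithms, and the algorithm is $1$-competitive: if $n\ge2$ and a deterministic offline comparison algorithm, which knows a given sequence of $q$ selection queries in advance, answers them correctly on all arrays of $n$ distinct elements with at most $W$ comparisons, then $\mathcal B(S_q)\le W$, and the online algorithm serves the same queries on every array of $n$ elements with at most $W\bigl(1+\omega(\mathcal B(S_q)/n)\bigr)+C\,n$ comparisons. -/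

import Mathlib

universe u

namespace Multiselection

/-- A deterministic comparison-based procedure (a finite binary decision tree) on items named by
`ι`, with results in `β`. A node `cmp x y t e` asks the single question "is `x ≤ y`?" and continues
with `t` if the answer is yes and with `e` if it is no. Item values are accessible in no other
way. -/
inductive CompTree (ι β : Type) : Type
  | done (b : β) : CompTree ι β
  | cmp (x y : ι) (t e : CompTree ι β) : CompTree ι β

namespace CompTree

variable {ι β : Type} {α : Type*} [LinearOrder α]

/-- The result of the procedure when item `x` has the value `v x`. -/
def output (v : ι → α) : CompTree ι β → β
  | done b => b
  | cmp x y t e => if v x ≤ v y then t.output v else e.output v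

/-- The number of comparisons that the procedure performs when item `x` has the value `v x`. -/
def cost (v : ι → α) : CompTree ι β → ℕ
  | done _ => 0
  | cmp x y t e => 1 + if v x ≤ v y then t.cost v else e.cost v

end CompTree

/-- A query on an array of length `n` over `α`: either select the element of a given rank (ranks
are counted from `0` here, so `select s` asks for the element of rank `s + 1` when counting
from `1`), or search for a key. -/
inductive Query (n : ℕ) (α : Type*)
  | select (s : Fin n)
  | search (p : α)

/-- The answer to a selection is (a pointer to) an array element, given by its index in the input
array; the answer to a search is a position. -/
inductive Answer (n : ℕ)
  | element (i : Fin n)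
  | position (j : ℕ)

/-- A deterministic online algorithm for arrays of length `n`. It first preprocesses the array and
then serves one query at a time. All that it knows about the array is its current state, which is
computed from the outcomes of earlier comparisons and the earlier requests. On a selection it may
compare array elements; on a search it may also compare array elements with the key, which is the
item `none`. -/
structure OnlineAlgorithm (n : ℕ) where
  State : Type
  init : CompTree (Fin n) State
  select : State → Fin n → CompTree (Fin n) (Fin n × State)
  search : State → CompTree (Option (Fin n)) (ℕ × State)

section Semantics

variable {n : ℕ} {α : Type*} [LinearOrder α]

/-- Values of the items available during a search for `p` in `A`. -/
def withKey (A : Fin n → α) (p : α) : Option (Fin n) → α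
  | none => p
  | some i => A i

namespace OnlineAlgorithm

variable (alg : OnlineAlgorithm n) (A : Fin n → α)

/-- Answer given to one query, and the new state. -/
def step (σ : alg.State) : Query n α → Answer n × alg.State
  | .select s =>
      let r := (alg.select σ s).output A
      (.element r.1, r.2)
  | .search p =>
      let r := (alg.search σ).output (withKey A p)
      (.position r.1, r.2)

/-- Number of comparisons used for one query. -/
def stepCost (σ : alg.State) : Query n α → ℕ
  | .select s => (alg.select σ s).cost A
  | .search p => (alg.search σ).cost (withKey A p)

/-- Answers to a sequence of queries, served one after the other from state `σ`. -/
def answersFrom (σ : alg.State) : List (Query n α) → List (Answer n)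
  | [] => []
  | Q :: Qs => (alg.step A σ Q).1 :: answersFrom (alg.step A σ Q).2 Qs

/-- Number of comparisons for a sequence of queries, served one after the other from `σ`. -/
def costFrom (σ : alg.State) : List (Query n α) → ℕ
  | [] => 0
  | Q :: Qs => alg.stepCost A σ Q + costFrom (alg.step A σ Q).2 Qs

/-- Answers to the query sequence `Q` on the array `A`. -/
def answers (Q : List (Query n α)) : List (Answer n) :=
  alg.answersFrom A (alg.init.output A) Q

/-- Total number of comparisons on array `A` and query sequence `Q`, preprocessing included. -/
def totalCost (Q : List (Query n α)) : ℕ :=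
  alg.init.cost A + alg.costFrom A (alg.init.output A) Q

end OnlineAlgorithm

/-- The array `A` in sorted order. -/
def sorted (A : Fin n → α) : Fin n → α := A ∘ Tuple.sort A

/-- The position returned by a search for `p`: if `p` occurs in `A`, its (first) position, counted
from `1`, in the sorted array; otherwise the number of elements smaller than `p`. -/
def searchPosition (A : Fin n → α) (p : α) : ℕ :=
  if ∃ i, A i = p then (Finset.univ.filter fun i => A i < p).card + 1
  else (Finset.univ.filter fun i => A i < p).card

/-- The answer is correct for the query on array `A`. -/
def IsCorrect (A : Fin n → α) : Query n α → Answer n → Prop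
  | .select s, .element i => A i = sorted A s
  | .search p, .position j => j = searchPosition A p
  | _, _ => False

/-- The rank (counted from `1`) that a query asks for: a search counts as the selection at the
position that it returns. -/
def queryRank (A : Fin n → α) : Query n α → ℕ
  | .select s => s + 1
  | .search p => searchPosition A p

/-- Whether the query is a search. -/
def Query.isSearch : Query n α → Bool
  | .select _ => false
  | .search _ => true

/-- `q'`: the number of searches in a query sequence. -/
def searchCount (Q : List (Query n α)) : ℕ := Q.countP Query.isSearch

end Semantics

/-- The gaps `Δ_i = s_{i+1} - s_i`, `0 ≤ i ≤ q`, where `s_1 ≤ … ≤ s_q` are the entries of `S` in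
sorted order, `s_0 = 0` and `s_{q+1} = n`. -/
def gaps (n : ℕ) (S : List ℕ) : List ℕ :=
  List.zipWith (fun a b => b - a) (0 :: S.insertionSort (· ≤ ·)) (S.insertionSort (· ≤ ·) ++ [n])

/-- `𝓑(S) = log₂ n! - ∑ᵢ log₂ (Δᵢ!)`. -/
noncomputable def infoBound (n : ℕ) (S : List ℕ) : ℝ :=
  Real.logb 2 (n.factorial : ℝ) -
    ((gaps n S).map fun d => Real.logb 2 (d.factorial : ℝ)).sum

/-- `T` is a correct offline multiselection algorithm for the selection queries `S`, all of which
are known in advance: on every array of `n` distinct elements its result lists the (indices of the)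
elements of the required ranks. -/
def SolvesOffline {n : ℕ} (S : List (Fin n)) (T : CompTree (Fin n) (List (Fin n))) : Prop :=
  ∀ A : Fin n → ℕ, Function.Injective A →
    List.Forall₂ (fun s i => A i = sorted A s) S (T.output A)

/-- `T` uses at most `W` comparisons on every array of `n` distinct elements. -/
def WorstCaseAtMost {n : ℕ} (T : CompTree (Fin n) (List (Fin n))) (W : ℕ) : Prop :=
  ∀ A : Fin n → ℕ, Function.Injective A → T.cost A ≤ W

end Multiselection

/-! The sorted order is kept as a list of consecutive blocks with known maxima, and a query refines
only the block that contains its rank until that rank is isolated. A block of level t is cut into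
pieces smaller by the factor 2^(t+1), so a block of level t is a singleton or has at most n /
2^(t(t+1)/2) elements (`Invariant`). Cutting m elements costs m (t + O(1)) comparisons
(`exists_split`): elements enter buckets by binary search, and an overflowing bucket is halved by
linear-time selection. The growing arity makes the leading constant 1: an element of level t has
paid t(t+1)/2 + O(t), and O(t) is only the square root of the main term.

An element of level t + 1 lay in a split block of level t that touched a requested cut. Its distance
δ to that cut satisfies depth t ≤ log₂(n/δ), so it has paid log₂(n/δ) + O(√log₂(n/δ) + 1). In a gap
of length d the product of such distances is at least d!/4^d (`factorial_le_prod_dist`), so the main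
terms sum to at most 𝓑 + O(n); by Cauchy–Schwarz the roots sum to at most √(n𝓑) + O(n)
(`Invariant.potential_le`). The root term is o(𝓑) if 𝓑/n is large and O(n) otherwise. A search finds
its block by binary search and scans it; the scan is paid by slack in the charge for splits. Ties
are broken by index, which reduces arrays to permutations.

For the lower bound, permutations with equal comparison outcomes agree on the elements up to each
requested rank (`SolvesOffline.le_iff_of_trace_eq`). Hence at most ∏ Δᵢ! permutations share a trace,
while there are at most 2^W traces. -/

namespace Multiselection

/-! ### Comparison trees and basic subroutines -/

namespace CompTree

variable {ι β γ : Type} {α : Type*} [LinearOrder α]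

/-- Sequential composition of comparison procedures. -/
def bind : CompTree ι β → (β → CompTree ι γ) → CompTree ι γ
  | done b, f => f b
  | cmp x y t e, f => cmp x y (t.bind f) (e.bind f)

@[simp] theorem output_done (v : ι → α) (b : β) : (done b : CompTree ι β).output v = b := rfl

@[simp] theorem cost_done (v : ι → α) (b : β) : (done b : CompTree ι β).cost v = 0 := rfl

@[simp] theorem output_bind (v : ι → α) (T : CompTree ι β) (f : β → CompTree ι γ) :
    (T.bind f).output v = (f (T.output v)).output v := by
  induction T with
  | done b => rfl
  | cmp x y t e iht ihe => simp only [bind, output]; split_ifs <;> assumption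

@[simp] theorem cost_bind (v : ι → α) (T : CompTree ι β) (f : β → CompTree ι γ) :
    (T.bind f).cost v = T.cost v + (f (T.output v)).cost v := by
  induction T with
  | done b => simp [bind]
  | cmp x y t e iht ihe =>
    simp only [bind, output, cost]
    split_ifs <;> simp [*, add_assoc]

/-- Renaming of the items. -/
def mapItems {κ : Type} (f : ι → κ) : CompTree ι β → CompTree κ β
  | done b => done b
  | cmp x y t e => cmp (f x) (f y) (t.mapItems f) (e.mapItems f)

theorem output_mapItems {κ : Type} (f : ι → κ) (v : κ → α) (T : CompTree ι β) :
    (T.mapItems f).output v = T.output (v ∘ f) := by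
  induction T with
  | done b => rfl
  | cmp x y t e iht ihe => simp [mapItems, output, iht, ihe]

theorem cost_mapItems {κ : Type} (f : ι → κ) (v : κ → α) (T : CompTree ι β) :
    (T.mapItems f).cost v = T.cost (v ∘ f) := by
  induction T with
  | done b => rfl
  | cmp x y t e iht ihe => simp [mapItems, cost, iht, ihe]

/-- The subset of a finite set that passes a comparison test can be found with one comparison per
element. -/
theorem exists_filter {κ : Type} [DecidableEq κ] (X : Finset κ) (f g : κ → ι) :
    ∃ T : CompTree ι (Finset κ), ∀ (α : Type u) [LinearOrder α] (v : ι → α),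
      T.output v = X.filter (fun x => v (f x) ≤ v (g x)) ∧ T.cost v ≤ X.card := by
  induction X using Finset.induction_on with
  | empty => exact ⟨done ∅, fun α _ v => by simp⟩
  | insert a X ha ih =>
    obtain ⟨T, hT⟩ := ih
    refine ⟨T.bind fun Y => cmp (f a) (g a) (done (insert a Y)) (done Y), fun α _ v => ?_⟩
    obtain ⟨h1, h2⟩ := hT α v
    rw [Finset.filter_insert, Finset.card_insert_of_notMem ha]
    simp only [output_bind, cost_bind, h1, output, cost]
    split_ifs <;> simp [h2]

/-- Binary search: a list that is sorted by its keys is cut at an item. -/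
theorem exists_binarySearch {κ : Type} (key : κ → ι) (x : ι) (j : ℕ) :
    ∀ l : List κ, l.length < 2 ^ j →
    ∃ T : CompTree ι (List κ × List κ), ∀ (α : Type u) [LinearOrder α] (v : ι → α),
      l.Pairwise (fun b c => v (key b) ≤ v (key c)) →
      (T.output v).1 ++ (T.output v).2 = l ∧ (∀ b ∈ (T.output v).1, v (key b) < v x) ∧
        (∀ b ∈ (T.output v).2, v x ≤ v (key b)) ∧ T.cost v ≤ j := by
  induction j with
  | zero =>
    intro l hl
    have : l = [] := by simpa using hl
    subst this
    exact ⟨done ([], []), fun α _ v _ => by simp⟩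
  | succ j ih =>
    intro l hl
    rcases Nat.eq_zero_or_pos l.length with h0 | hpos
    · have : l = [] := by simpa using h0
      subst this
      exact ⟨done ([], []), fun α _ v _ => by simp⟩
    · obtain ⟨p, b, q, rfl, hp, hq⟩ : ∃ p b q, l = p ++ b :: q ∧ p.length < 2 ^ j ∧
          q.length < 2 ^ j := by
        -- Of fewer than 2^(j+1) items, fewer than 2^j remain on each side of the middle one.
        have hlt : l.length / 2 < l.length := by omega
        refine ⟨l.take (l.length / 2), l[l.length / 2], l.drop (l.length / 2 + 1), ?_, ?_, ?_⟩
        · simp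
        · rw [List.length_take]; rw [pow_succ] at hl; omega
        · rw [List.length_drop]; rw [pow_succ] at hl; omega
      obtain ⟨T₁, h₁⟩ := ih p hp
      obtain ⟨T₂, h₂⟩ := ih q hq
      refine ⟨cmp x (key b) (T₁.bind fun r => done (r.1, r.2 ++ b :: q))
        (T₂.bind fun r => done (p ++ b :: r.1, r.2)), fun α _ v hs => ?_⟩
      rw [List.pairwise_append, List.pairwise_cons] at hs
      obtain ⟨hs1, ⟨hs2, hs3⟩, hs4⟩ := hs
      simp only [output, cost, output_bind, cost_bind]
      split_ifs with hx
      · obtain ⟨e, h3, h4, h5⟩ := h₁ α v hs1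
        refine ⟨by simp [← e], h3, ?_, by simp; omega⟩
        intro c hc
        simp only [List.mem_append, List.mem_cons] at hc
        rcases hc with hc | rfl | hc
        · exact h4 c hc
        · exact hx
        · exact hx.trans (hs2 c hc)
      · obtain ⟨e, h3, h4, h5⟩ := h₂ α v hs3
        refine ⟨by simp [← e], ?_, h4, by simp; omega⟩
        intro c hc
        simp only [List.mem_append, List.mem_cons] at hc
        rcases hc with hc | rfl | hc
        · exact (hs4 c hc b (by simp)).trans_lt (not_le.1 hx)
        · exact not_le.1 hx
        · exact h3 c hc

theorem exists_max (X : Finset ι) (hX : X.Nonempty) :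
    ∃ T : CompTree ι ι, ∀ (α : Type u) [LinearOrder α] (v : ι → α),
      T.output v ∈ X ∧ (∀ x ∈ X, v x ≤ v (T.output v)) ∧ T.cost v ≤ X.card := by
  classical
  induction hX using Finset.Nonempty.cons_induction with
  | singleton a => exact ⟨done a, fun α _ v => by simp⟩
  | cons a X ha hX ih =>
    obtain ⟨T, hT⟩ := ih
    refine ⟨T.bind fun b => cmp a b (done b) (done a), fun α _ v => ?_⟩
    obtain ⟨h1, h2, h3⟩ := hT α v
    simp only [output_bind, cost_bind, output, cost, Finset.mem_cons, Finset.card_cons]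
    split_ifs with h
    · exact ⟨Or.inr h1, by rintro x (rfl | hx); exacts [h, h2 x hx], by simp; omega⟩
    · refine ⟨Or.inl rfl, ?_, by simp; omega⟩
      rintro x (rfl | hx)
      · exact le_rfl
      · exact (h2 x hx).trans (not_le.1 h).le

end CompTree

open CompTree

/-! ### Selection in linear time -/

section Selection

variable {ι : Type} [DecidableEq ι]

/-- `y` is the element of rank `r` (counted from `0`) of the set `X`. -/
def HasRank (v : ι → ℕ) (X : Finset ι) (r : ℕ) (y : ι) : Prop :=
  y ∈ X ∧ (X.filter fun x => v x < v y).card = r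

theorem HasRank.card_le {v : ι → ℕ} (hv : Function.Injective v) {X : Finset ι} {r : ℕ} {y : ι}
    (h : HasRank v X r y) : (X.filter fun x => v x ≤ v y).card = r + 1 := by
  have : (X.filter fun x => v x ≤ v y) = insert y (X.filter fun x => v x < v y) := by
    ext x
    simp only [Finset.mem_filter, Finset.mem_insert]
    constructor
    · rintro ⟨h1, h2⟩
      rcases h2.lt_or_eq with h2 | h2
      · exact Or.inr ⟨h1, h2⟩
      · exact Or.inl (hv h2)
    · rintro (rfl | ⟨h1, h2⟩)
      · exact ⟨h.1, le_rfl⟩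
      · exact ⟨h1, h2.le⟩
  rw [this, Finset.card_insert_of_notMem (by simp), h.2]

theorem HasRank.card_ge {ι : Type} {v : ι → ℕ} {X : Finset ι} {r : ℕ} {y : ι}
    (h : HasRank v X r y) : (X.filter fun x => v y ≤ v x).card = X.card - r := by
  have := Finset.card_filter_add_card_filter_not (s := X) (fun x => v x < v y)
  simp only [not_lt] at this
  rw [h.2] at this
  omega

/-- Selection with quadratically many comparisons. -/
theorem exists_select_sq (N : ℕ) : ∀ (X : Finset ι) (r : ℕ), X.card = N → r < N →
    ∃ T : CompTree ι ι, ∀ v : ι → ℕ, Function.Injective v →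
      HasRank v X r (T.output v) ∧ T.cost v ≤ N * N := by
  induction N with
  | zero => intro X r _ h; omega
  | succ N ih =>
    intro X r hX hr
    obtain ⟨T, hT⟩ := exists_max.{0} X (Finset.card_pos.1 (by omega))
    -- A tree is fixed before any value is seen, so a continuation is provided for every conceivable
    -- outcome of the previous stage; impossible outcomes get an arbitrary tree. The same pattern
    -- recurs in the later constructions.
    have hstep : ∀ m : ι, ∃ U : CompTree ι ι, ∀ v : ι → ℕ, Function.Injective v → m ∈ X →
        (∀ x ∈ X, v x ≤ v m) → HasRank v X r (U.output v) ∧ U.cost v ≤ N * N := by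
      intro m
      by_cases hm : m ∈ X
      · have hc : (X.erase m).card = N := by rw [Finset.card_erase_of_mem hm]; omega
        rcases Nat.lt_succ_iff_lt_or_eq.1 hr with hr' | rfl
        · obtain ⟨U, hU⟩ := ih (X.erase m) r hc hr'
          refine ⟨U, fun v hv _ hmax => ?_⟩
          obtain ⟨⟨h1, h2⟩, h3⟩ := hU v hv
          have h1' := Finset.mem_of_mem_erase h1
          refine ⟨⟨h1', ?_⟩, h3⟩
          rw [← h2]
          congr 1
          ext x
          simp only [Finset.mem_filter, Finset.mem_erase]
          constructor
          · rintro ⟨h4, h5⟩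
            refine ⟨⟨?_, h4⟩, h5⟩
            rintro rfl
            exact absurd (hmax _ h1') (by omega)
          · rintro ⟨⟨_, h4⟩, h5⟩
            exact ⟨h4, h5⟩
        · refine ⟨done m, fun v hv _ hmax => ⟨⟨hm, ?_⟩, by simp⟩⟩
          change (X.filter fun x => v x < v m).card = r
          rw [← hc]
          congr 1
          ext x
          simp only [Finset.mem_filter, Finset.mem_erase]
          constructor
          · rintro ⟨h4, h5⟩
            exact ⟨by rintro rfl; omega, h4⟩
          · rintro ⟨h4, h5⟩
            exact ⟨h5, lt_of_le_of_ne (hmax x h5) (fun h => h4 (hv h))⟩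
      · exact ⟨done m, fun v _ h => absurd h hm⟩
    choose U hU using hstep
    refine ⟨T.bind U, fun v hv => ?_⟩
    obtain ⟨h1, h2, h3⟩ := hT ℕ v
    obtain ⟨h4, h5⟩ := hU _ v hv h1 h2
    refine ⟨by simpa using h4, ?_⟩
    simp only [cost_bind]
    nlinarith

/-- Medians of disjoint groups of five: a subset of a fifth of the elements, each of which stands
for three smaller (larger) elements. -/
theorem exists_groupMedians (k : ℕ) : ∀ X : Finset ι, 5 * k ≤ X.card →
    ∃ T : CompTree ι (Finset ι), ∀ v : ι → ℕ, Function.Injective v →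
      T.output v ⊆ X ∧ (T.output v).card = k ∧
      (∀ y, 3 * ((T.output v).filter fun z => v z ≤ y).card ≤ (X.filter fun x => v x ≤ y).card) ∧
      (∀ y, 3 * ((T.output v).filter fun z => y ≤ v z).card ≤ (X.filter fun x => y ≤ v x).card) ∧
      T.cost v ≤ 25 * k := by
  induction k with
  | zero => exact fun X _ => ⟨done ∅, fun v _ => by simp⟩
  | succ k ih =>
    intro X hX
    obtain ⟨G, hGX, hG⟩ := Finset.exists_subset_card_eq (show 5 ≤ X.card by omega)
    have hc : (X \ G).card = X.card - 5 := by rw [Finset.card_sdiff_of_subset hGX, hG]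
    obtain ⟨T, hT⟩ := ih (X \ G) (by omega)
    -- A median of five has three members of its group on either side, itself included; it costs 5 ·
    -- 5 comparisons.
    obtain ⟨U, hU⟩ := exists_select_sq 5 G 2 hG (by norm_num)
    refine ⟨T.bind fun M => U.bind fun m => done (insert m M), fun v hv => ?_⟩
    obtain ⟨h1, h2, h3, h4, h5⟩ := hT v hv
    obtain ⟨h6, h7⟩ := hU v hv
    simp only [output_bind, cost_bind, output_done, cost_done]
    set M := T.output v
    set m := U.output v
    have hm : m ∉ M := fun h => (Finset.mem_sdiff.1 (h1 h)).2 h6.1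
    have hdis : Disjoint (X \ G) G := Finset.sdiff_disjoint
    have hun : (X \ G) ∪ G = X := Finset.sdiff_union_of_subset hGX
    refine ⟨?_, by rw [Finset.card_insert_of_notMem hm, h2], fun y => ?_, fun y => ?_, by omega⟩
    · exact Finset.insert_subset (hGX h6.1) (h1.trans Finset.sdiff_subset)
    · have e : (X.filter fun x => v x ≤ y).card =
          ((X \ G).filter fun x => v x ≤ y).card + (G.filter fun x => v x ≤ y).card := by
        rw [← Finset.card_union_of_disjoint (Finset.disjoint_filter_filter hdis),
          ← Finset.filter_union, hun]
      rw [e, Finset.filter_insert]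
      split_ifs with hy
      · rw [Finset.card_insert_of_notMem (by simp [hm])]
        have h8 : (G.filter fun x => v x ≤ v m).card ≤ (G.filter fun x => v x ≤ y).card :=
          Finset.card_le_card (Finset.monotone_filter_right _ fun x _ hx => le_trans hx hy)
        rw [h6.card_le hv] at h8
        have := h3 y
        omega
      · have := h3 y
        omega
    · have e : (X.filter fun x => y ≤ v x).card =
          ((X \ G).filter fun x => y ≤ v x).card + (G.filter fun x => y ≤ v x).card := by
        rw [← Finset.card_union_of_disjoint (Finset.disjoint_filter_filter hdis),
          ← Finset.filter_union, hun]
      rw [e, Finset.filter_insert]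
      split_ifs with hy
      · rw [Finset.card_insert_of_notMem (by simp [hm])]
        have h8 : (G.filter fun x => v m ≤ v x).card ≤ (G.filter fun x => y ≤ v x).card :=
          Finset.card_le_card (Finset.monotone_filter_right _ fun x _ hx => le_trans hy hx)
        rw [h6.card_ge, hG] at h8
        have := h4 y
        omega
      · have := h4 y
        omega

/-- Selection with linearly many comparisons, by the median of medians. -/
theorem exists_select_linear (N : ℕ) : ∀ (X : Finset ι) (r : ℕ), X.card = N → r < N →
    ∃ T : CompTree ι ι, ∀ v : ι → ℕ, Function.Injective v →
      HasRank v X r (T.output v) ∧ T.cost v ≤ 70 * N := by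
  induction N using Nat.strong_induction_on with
  | _ N ih =>
    intro X r hX hr
    rcases Nat.lt_or_ge N 5 with hN | hN
    · obtain ⟨T, hT⟩ := exists_select_sq N X r hX hr
      exact ⟨T, fun v hv => ⟨(hT v hv).1, (hT v hv).2.trans (by nlinarith)⟩⟩
    · obtain ⟨k, hk⟩ : ∃ k, k = N / 5 := ⟨_, rfl⟩
      obtain ⟨TM, hTM⟩ := exists_groupMedians k X (by omega)
      have hmed : ∀ M : Finset ι, ∃ U : CompTree ι ι, ∀ v : ι → ℕ, Function.Injective v →
          M.card = k → HasRank v M (k / 2) (U.output v) ∧ U.cost v ≤ 70 * k := by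
        intro M
        by_cases hM : M.card = k
        · obtain ⟨U, hU⟩ := ih k (by omega) M (k / 2) hM (by omega)
          exact ⟨U, fun v hv _ => hU v hv⟩
        · obtain ⟨x, -⟩ := Finset.card_pos.1 (show 0 < X.card by omega)
          exact ⟨done x, fun v _ h => absurd h hM⟩
      choose U hU using hmed
      choose F hF using fun y : ι => exists_filter.{0} X id (fun _ => y)
      have hrec : ∀ (y : ι) (L : Finset ι), ∃ R : CompTree ι ι, ∀ v : ι → ℕ,
          Function.Injective v → y ∈ X → L = X.filter (fun x => v x ≤ v y) →
          3 * k ≤ 2 * L.card → 3 * k ≤ 2 * (X.filter fun x => v y ≤ v x).card →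
          HasRank v X r (R.output v) ∧ 2 * R.cost v ≤ 70 * (2 * N - 3 * k) := by
        intro y L
        -- The shape of the tree may depend only on the sets, not on values. The conditions say that
        -- both sides of the pivot `y` have at most N - 3k/2 elements.
        by_cases hL : L ⊆ X ∧ y ∈ L ∧ 3 * k ≤ 2 * L.card ∧ 2 * (L.erase y).card ≤ 2 * N - 3 * k
        · obtain ⟨hLX, hyL, hL1, hL2⟩ := hL
          have hLe : (L.erase y).card + 1 = L.card := Finset.card_erase_add_one hyL
          have hLc : L.card ≤ N := hX ▸ Finset.card_le_card hLX
          have hxL : (X \ L).card = N - L.card := by rw [Finset.card_sdiff_of_subset hLX, hX]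
          have hlt : ∀ v : ι → ℕ, Function.Injective v → L = X.filter (fun x => v x ≤ v y) →
              L.erase y = X.filter (fun x => v x < v y) := by
            intro v hv h
            ext x
            rw [h]
            simp only [Finset.mem_erase, Finset.mem_filter]
            constructor
            · rintro ⟨h1, h2, h3⟩
              exact ⟨h2, lt_of_le_of_ne h3 (fun h => h1 (hv h))⟩
            · rintro ⟨h2, h3⟩
              exact ⟨by rintro rfl; omega, h2, h3.le⟩
          rcases lt_trichotomy r (L.erase y).card with h | h | h
          · obtain ⟨R, hR⟩ := ih _ (by omega) (L.erase y) r rfl h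
            refine ⟨R, fun v hv _ hLv _ _ => ?_⟩
            obtain ⟨⟨h1, h2⟩, h3⟩ := hR v hv
            rw [hlt v hv hLv] at h1 h2
            rw [Finset.mem_filter] at h1
            refine ⟨⟨h1.1, ?_⟩, by omega⟩
            rw [← h2, Finset.filter_filter]
            congr 1
            ext x
            simp only [Finset.mem_filter, and_congr_right_iff]
            omega
          · refine ⟨done y, fun v hv hy hLv _ _ => ⟨⟨hy, ?_⟩, by simp⟩⟩
            rw [h, hlt v hv hLv]
            rfl
          · obtain ⟨R, hR⟩ := ih _ (show (X \ L).card < N by omega) (X \ L) (r - L.card) rfl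
              (by omega)
            refine ⟨R, fun v hv _ hLv _ _ => ?_⟩
            obtain ⟨⟨h1, h2⟩, h3⟩ := hR v hv
            have hmem : ∀ x, x ∈ X \ L ↔ x ∈ X ∧ v y < v x := by
              intro x
              rw [Finset.mem_sdiff, hLv, Finset.mem_filter]
              constructor
              · rintro ⟨a, b⟩
                exact ⟨a, by by_contra hc; exact b ⟨a, by omega⟩⟩
              · rintro ⟨a, b⟩
                exact ⟨a, fun hc => by omega⟩
            have h1' := (hmem _).1 h1
            refine ⟨⟨h1'.1, ?_⟩, by omega⟩
            have e : X.filter (fun x => v x < v (R.output v)) =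
                L ∪ (X \ L).filter (fun x => v x < v (R.output v)) := by
              ext x
              rw [Finset.mem_union, Finset.mem_filter, Finset.mem_filter, hmem, hLv,
                Finset.mem_filter]
              constructor
              · rintro ⟨a, b⟩
                by_cases c : v x ≤ v y
                · exact Or.inl ⟨a, c⟩
                · exact Or.inr ⟨⟨a, by omega⟩, b⟩
              · rintro (⟨a, b⟩ | ⟨⟨a, b⟩, c⟩)
                · exact ⟨a, by omega⟩
                · exact ⟨a, c⟩
            rw [e, Finset.card_union_of_disjoint, h2]
            · omega
            · exact Finset.disjoint_of_subset_right (Finset.filter_subset _ _)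
                Finset.disjoint_sdiff
        · refine ⟨done y, fun v hv hy hLv h1 h2 => absurd ?_ hL⟩
          have hyL : y ∈ L := by rw [hLv]; simp [hy]
          refine ⟨by rw [hLv]; exact Finset.filter_subset _ _, hyL, h1, ?_⟩
          have hLe : (L.erase y).card + 1 = L.card := Finset.card_erase_add_one hyL
          have hr : HasRank v X (X.filter fun x => v x < v y).card y := ⟨hy, rfl⟩
          have h3 := hr.card_le hv
          rw [← hLv] at h3
          have h4 := hr.card_ge
          have h5 : (X.filter fun x => v x < v y).card ≤ X.card :=
            Finset.card_le_card (Finset.filter_subset _ _)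
          omega
      choose R hR using hrec
      refine ⟨TM.bind fun M => (U M).bind fun y => (F y).bind (R y), fun v hv => ?_⟩
      obtain ⟨h1, h2, h3, h4, h5⟩ := hTM v hv
      obtain ⟨h6, h7⟩ := hU _ v hv h2
      obtain ⟨h8, h9⟩ := hF ((U (TM.output v)).output v) ℕ v
      have h3' := h3 (v ((U (TM.output v)).output v))
      have h4' := h4 (v ((U (TM.output v)).output v))
      rw [h6.card_le hv] at h3'
      rw [h6.card_ge, h2] at h4'
      obtain ⟨h10, h11⟩ := hR ((U (TM.output v)).output v) _ v hv (h1 h6.1) h8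
        (by rw [h8]; simp only [id]; omega) (by omega)
      simp only [output_bind, cost_bind]
      -- The groups cost 25k, the pivot 70k, the partition N and the recursion 70 (N - 3k/2). The
      -- sum is 70N + N - 10k, and N ≤ 5k + 4 ≤ 10k.
      exact ⟨h10, by omega⟩

/-- Splitting a set at its median. -/
theorem exists_halve (X : Finset ι) (hX : 2 ≤ X.card) :
    ∃ T : CompTree ι (ι × Finset ι), ∀ v : ι → ℕ, Function.Injective v →
      (T.output v).1 ∈ (T.output v).2 ∧
      (T.output v).2 = X.filter (fun x => v x ≤ v (T.output v).1) ∧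
      (T.output v).2.card = X.card / 2 ∧ T.cost v ≤ 71 * X.card := by
  obtain ⟨T, hT⟩ := exists_select_linear X.card X (X.card / 2 - 1) rfl (by omega)
  choose F hF using fun y : ι => exists_filter.{0} X id (fun _ => y)
  refine ⟨T.bind fun y => (F y).bind fun L => done (y, L), fun v hv => ?_⟩
  obtain ⟨h1, h2⟩ := hT v hv
  obtain ⟨h3, h4⟩ := hF (T.output v) ℕ v
  have h5 := h1.card_le hv
  simp only [output_bind, cost_bind, output_done, cost_done, h3, id]
  exact ⟨by simp [h1.1], trivial, by omega, by omega⟩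

end Selection

end Multiselection

/-! ### Layouts in consecutive blocks, and bucketing -/

namespace Multiselection

open CompTree

/-- A block of consecutive elements of the sorted order, with its largest element `top`. The level
`lev` is the number of splits that led to the block. -/
structure Block (ι : Type) where
  lev : ℕ
  top : ι
  els : Finset ι

/-- The number of elements in a list of blocks. -/
def totalCard {ι : Type} (bs : List (Block ι)) : ℕ := (bs.map fun b => b.els.card).sum

/-- `bs` cuts `X` into consecutive blocks with known largest elements. -/
structure IsLayout {ι : Type} (v : ι → ℕ) (bs : List (Block ι)) (X : Finset ι) : Prop where
  ordered : bs.Pairwise fun b c => ∀ x ∈ b.els, ∀ y ∈ c.els, v x < v y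
  top_mem : ∀ b ∈ bs, b.top ∈ b.els
  le_top : ∀ b ∈ bs, ∀ x ∈ b.els, v x ≤ v b.top
  mem_iff : ∀ x, x ∈ X ↔ ∃ b ∈ bs, x ∈ b.els

section Layout

variable {ι : Type} {v : ι → ℕ}

theorem totalCard_append (bs cs : List (Block ι)) :
    totalCard (bs ++ cs) = totalCard bs + totalCard cs := by
  simp [totalCard]

theorem totalCard_cons (b : Block ι) (cs : List (Block ι)) :
    totalCard (b :: cs) = b.els.card + totalCard cs := by
  simp [totalCard]

theorem isLayout_nil : IsLayout v [] ∅ :=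
  ⟨List.Pairwise.nil, by simp, by simp, by simp⟩

theorem isLayout_singleton {b : Block ι} (h : b.top ∈ b.els) (h' : ∀ x ∈ b.els, v x ≤ v b.top) :
    IsLayout v [b] b.els :=
  ⟨by simp, by simpa using h, by simpa using h', by simp⟩

theorem IsLayout.of_singleton {b : Block ι} {X : Finset ι} (h : IsLayout v [b] X) : X = b.els := by
  ext x
  simp [h.mem_iff]

theorem IsLayout.pairwise_top {bs : List (Block ι)} {X : Finset ι} (h : IsLayout v bs X) :
    bs.Pairwise fun b c => v b.top ≤ v c.top :=
  h.ordered.imp_of_mem fun hb hc hbc => (hbc _ (h.top_mem _ hb) _ (h.top_mem _ hc)).le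

variable [DecidableEq ι]

theorem IsLayout.append {bs cs : List (Block ι)} {X Y : Finset ι} (h : IsLayout v bs X)
    (h' : IsLayout v cs Y) (hXY : ∀ x ∈ X, ∀ y ∈ Y, v x < v y) :
    IsLayout v (bs ++ cs) (X ∪ Y) where
  ordered := List.pairwise_append.2 ⟨h.ordered, h'.ordered, fun b hb c hc x hx y hy =>
    hXY x ((h.mem_iff x).2 ⟨b, hb, hx⟩) y ((h'.mem_iff y).2 ⟨c, hc, hy⟩)⟩
  top_mem b hb := (List.mem_append.1 hb).elim (h.top_mem b) (h'.top_mem b)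
  le_top b hb := (List.mem_append.1 hb).elim (h.le_top b) (h'.le_top b)
  mem_iff x := by
    rw [Finset.mem_union, h.mem_iff, h'.mem_iff]
    simp only [List.mem_append, or_and_right, exists_or]

theorem IsLayout.of_append {bs cs : List (Block ι)} {X : Finset ι}
    (h : IsLayout v (bs ++ cs) X) : ∃ Y Z, X = Y ∪ Z ∧ IsLayout v bs Y ∧ IsLayout v cs Z ∧
      ∀ y ∈ Y, ∀ z ∈ Z, v y < v z := by
  have ho := List.pairwise_append.1 h.ordered
  refine ⟨X.filter fun x => ∃ b ∈ bs, x ∈ b.els, X.filter fun x => ∃ b ∈ cs, x ∈ b.els, ?_,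
    ⟨ho.1, fun b hb => h.top_mem b (by simp [hb]), fun b hb => h.le_top b (by simp [hb]), ?_⟩,
    ⟨ho.2.1, fun b hb => h.top_mem b (by simp [hb]), fun b hb => h.le_top b (by simp [hb]), ?_⟩, ?_⟩
  · ext x
    simp only [Finset.mem_union, Finset.mem_filter, h.mem_iff, List.mem_append, or_and_right,
      exists_or]
    generalize (∃ b ∈ bs, x ∈ b.els) = p
    generalize (∃ b ∈ cs, x ∈ b.els) = q
    tauto
  · intro x
    rw [Finset.mem_filter, h.mem_iff]
    exact ⟨And.right, fun hx => ⟨hx.imp fun b hb => ⟨by simp [hb.1], hb.2⟩, hx⟩⟩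
  · intro x
    rw [Finset.mem_filter, h.mem_iff]
    exact ⟨And.right, fun hx => ⟨hx.imp fun b hb => ⟨by simp [hb.1], hb.2⟩, hx⟩⟩
  · intro y hy z hz
    obtain ⟨-, b, hb, hyb⟩ := Finset.mem_filter.1 hy
    obtain ⟨-, c, hc, hzc⟩ := Finset.mem_filter.1 hz
    exact ho.2.2 b hb c hc y hyb z hzc

/-- A block can be replaced by a layout of its elements. -/
theorem IsLayout.replace {p q bs : List (Block ι)} {b : Block ι} {X : Finset ι}
    (h : IsLayout v (p ++ b :: q) X) (hb : IsLayout v bs b.els) :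
    IsLayout v (p ++ (bs ++ q)) X := by
  obtain ⟨P, Y, rfl, hP, hY, hPY⟩ := h.of_append
  obtain ⟨B, Q, rfl, hB, hQ, hBQ⟩ := IsLayout.of_append (bs := [b]) hY
  obtain rfl := hB.of_singleton
  exact hP.append (hb.append hQ hBQ) hPY

/-- An element can be added to a block if it fits between the neighbours. -/
theorem IsLayout.insert_elem {p q : List (Block ι)} {b b' : Block ι} {X : Finset ι} {x : ι}
    (h : IsLayout v (p ++ b :: q) X) (hb : b'.els = insert x b.els) (ht : b'.top ∈ b'.els)
    (ht' : ∀ y ∈ b'.els, v y ≤ v b'.top) (hp : ∀ c ∈ p, ∀ y ∈ c.els, v y < v x)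
    (hq : ∀ c ∈ q, ∀ y ∈ c.els, v x < v y) :
    IsLayout v (p ++ b' :: q) (insert x X) := by
  obtain ⟨P, Y, rfl, hP, hY, hPY⟩ := h.of_append
  obtain ⟨B, Q, rfl, hB, hQ, hBQ⟩ := IsLayout.of_append (bs := [b]) hY
  obtain rfl := hB.of_singleton
  have e : insert x (P ∪ (b.els ∪ Q)) = P ∪ (b'.els ∪ Q) := by
    rw [hb]; ext y; simp
  rw [e]
  have h1 : IsLayout v ([b'] ++ q) (b'.els ∪ Q) := by
    refine (isLayout_singleton ht ht').append hQ ?_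
    intro y hy z hz
    rw [hb, Finset.mem_insert] at hy
    rcases hy with rfl | hy
    · obtain ⟨c, hc, hzc⟩ := (hQ.mem_iff z).1 hz
      exact hq c hc z hzc
    · exact hBQ y hy z hz
  refine hP.append h1 ?_
  intro y hy z hz
  simp only [hb, Finset.mem_union, Finset.mem_insert] at hz
  rcases hz with (rfl | hz) | hz
  · obtain ⟨c, hc, hyc⟩ := (hP.mem_iff y).1 hy
    exact hp c hc y hyc
  · exact hPY y hy z (by simp [hz])
  · exact hPY y hy z (by simp [hz])

theorem IsLayout.totalCard_eq {bs : List (Block ι)} : ∀ {X : Finset ι}, IsLayout v bs X →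
    totalCard bs = X.card := by
  induction bs with
  | nil =>
    intro X h
    have : X = ∅ := by ext x; simp [h.mem_iff]
    simp [this, totalCard]
  | cons b bs ih =>
    intro X h
    obtain ⟨B, Q, rfl, hB, hQ, hBQ⟩ := IsLayout.of_append (bs := [b]) h
    obtain rfl := hB.of_singleton
    rw [totalCard_cons, ih hQ, Finset.card_union_of_disjoint]
    exact Finset.disjoint_left.2 fun x hx hx' => (hBQ x hx x hx').false

theorem IsLayout.length_mul_le {bs : List (Block ι)} {X : Finset ι} (h : IsLayout v bs X) {w : ℕ}
    (hw : ∀ b ∈ bs, w ≤ b.els.card) : bs.length * w ≤ X.card := by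
  rw [← h.totalCard_eq, totalCard, ← smul_eq_mul, ← List.length_map (fun b : Block ι => b.els.card)]
  exact List.card_nsmul_le_sum _ _ (by simpa using hw)

/-- All blocks have level `t` and at most `u` elements; if there are several blocks, then they are
at least half full. -/
structure IsBucketing (t u : ℕ) (bs : List (Block ι)) : Prop where
  ne_nil : bs ≠ []
  lev_eq : ∀ b ∈ bs, b.lev = t
  card_le : ∀ b ∈ bs, b.els.card ≤ u
  half_full : bs.length = 1 ∨ ∀ b ∈ bs, u + 1 ≤ 3 * b.els.card

theorem IsBucketing.length_mul_le {bs : List (Block ι)} {X : Finset ι} {t u : ℕ}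
    (h : IsBucketing t u bs) (h' : IsLayout v bs X) :
    bs.length = 1 ∨ bs.length * (u + 1) ≤ 3 * X.card := by
  rcases h.half_full with h1 | h1
  · exact Or.inl h1
  · right
    -- This `w` is (u + 1)/3 rounded up.
    have := h'.length_mul_le (w := (u + 1 + 2) / 3) (fun b hb => by have := h1 b hb; omega)
    have h3 : u + 1 ≤ 3 * ((u + 1 + 2) / 3) := by omega
    calc bs.length * (u + 1) ≤ bs.length * (3 * ((u + 1 + 2) / 3)) := Nat.mul_le_mul_left _ h3
      _ = 3 * (bs.length * ((u + 1 + 2) / 3)) := by ring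
      _ ≤ _ := by omega

/-- Placing an element into its bucket by binary search. -/
theorem exists_place {j : ℕ} (bs : List (Block ι)) (x : ι) (hne : bs ≠ [])
    (hj : bs.length < 2 ^ j) :
    ∃ T : CompTree ι (List (Block ι) × Block ι × List (Block ι)), ∀ v : ι → ℕ,
      ∀ X, IsLayout v bs X →
      ∃ p b q b', bs = p ++ b :: q ∧ T.output v = (p, b', q) ∧ b'.lev = b.lev ∧
        b'.els = insert x b.els ∧ IsLayout v (p ++ b' :: q) (insert x X) ∧ T.cost v ≤ j := by
  obtain ⟨T, hT⟩ := exists_binarySearch.{0} Block.top x j bs hj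
  obtain ⟨b₀, hb₀⟩ := List.exists_mem_of_ne_nil bs hne
  -- An element above every top joins the last block and becomes its top. The default `b₀` is never
  -- used, since then the left part is the whole nonempty list.
  let f : List (Block ι) × List (Block ι) → List (Block ι) × Block ι × List (Block ι) := fun r =>
    match r.2 with
    | b :: q => (r.1, ⟨b.lev, b.top, insert x b.els⟩, q)
    | [] => (r.1.dropLast, ⟨(r.1.getLastD b₀).lev, x, insert x (r.1.getLastD b₀).els⟩, [])
  refine ⟨T.bind fun r => done (f r), fun v X hX => ?_⟩
  obtain ⟨h1, h2, h3, h4⟩ := hT ℕ v hX.pairwise_top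
  simp only [output_bind, cost_bind, output_done, cost_done, add_zero]
  obtain ⟨⟨p, q⟩, hr⟩ : ∃ r, r = T.output v := ⟨_, rfl⟩
  rw [← hr] at h1 h2 h3 ⊢
  simp only at h1 h2 h3
  rcases q with _ | ⟨b, q⟩
  · simp only [List.append_nil] at h1
    obtain ⟨p', b, rfl⟩ : ∃ p' b, p = p' ++ [b] := by
      rcases List.eq_nil_or_concat p with h | ⟨p', b, h⟩
      · exact absurd (h1 ▸ h) hne
      · exact ⟨p', b, by simpa using h⟩
    have hbx : v b.top < v x := h2 b (by simp)
    subst h1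
    refine ⟨p', b, [], ⟨b.lev, x, insert x b.els⟩, rfl, ?_, rfl, rfl, ?_, h4⟩
    · simp [f]
    · refine hX.insert_elem rfl (by simp) ?_ ?_ (by simp)
      · intro y hy
        rcases Finset.mem_insert.1 hy with rfl | hy
        · exact le_rfl
        · exact (hX.le_top b (by simp) y hy).trans hbx.le
      · intro c hc y hy
        exact (hX.le_top c (by simp [hc]) y hy).trans_lt (h2 c (by simp [hc]))
  · subst h1
    have hbx : v x ≤ v b.top := h3 b (by simp)
    refine ⟨p, b, q, ⟨b.lev, b.top, insert x b.els⟩, rfl, rfl, rfl, rfl, ?_, h4⟩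
    refine hX.insert_elem rfl (by simp [hX.top_mem b]) ?_ ?_ ?_
    · intro y hy
      rcases Finset.mem_insert.1 hy with rfl | hy
      · exact hbx
      · exact hX.le_top b (by simp) y hy
    · intro c hc y hy
      exact (hX.le_top c (by simp [hc]) y hy).trans_lt (h2 c hc)
    · intro c hc y hy
      have := (List.pairwise_cons.1 (List.pairwise_append.1 hX.ordered).2.1).1 c hc b.top
        (hX.top_mem b (by simp)) y hy
      omega

/-- Inserting an element into a bucketing. The buckets are counted to pay for splits. -/
theorem exists_insert {t u j : ℕ} (hu : 1 ≤ u) (bs : List (Block ι)) (x : ι)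
    (hbs : IsBucketing t u bs) (hj : bs.length < 2 ^ j) :
    ∃ T : CompTree ι (List (Block ι)), ∀ v : ι → ℕ, Function.Injective v →
      ∀ X, IsLayout v bs X →
      IsLayout v (T.output v) (insert x X) ∧ IsBucketing t u (T.output v) ∧
      T.cost v + 71 * (u + 1) * bs.length ≤ j + 71 * (u + 1) * (T.output v).length := by
  obtain ⟨T, hT⟩ := exists_place bs x hbs.ne_nil hj
  have hsplit : ∀ r : List (Block ι) × Block ι × List (Block ι),
      ∃ U : CompTree ι (List (Block ι)), ∀ v : ι → ℕ, Function.Injective v →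
      ∀ X, IsLayout v (r.1 ++ r.2.1 :: r.2.2) X → r.2.1.els.card ≤ u + 1 →
        IsLayout v (U.output v) X ∧
        ((U.output v = r.1 ++ r.2.1 :: r.2.2 ∧ r.2.1.els.card ≤ u ∧ U.cost v = 0) ∨
         (∃ b c, U.output v = r.1 ++ ([b, c] ++ r.2.2) ∧ b.lev = r.2.1.lev ∧ c.lev = r.2.1.lev ∧
           b.els.card ≤ u ∧ c.els.card ≤ u ∧ u + 1 ≤ 3 * b.els.card ∧ u + 1 ≤ 3 * c.els.card ∧
           U.cost v ≤ 71 * (u + 1))) := by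
    rintro ⟨p, b, q⟩
    rcases Nat.lt_or_ge u b.els.card with hb | hb
    -- An overfull bucket has exactly u + 1 elements. Rounding leaves at least a third of them in
    -- each half, and the new bucket pays for the 71 (u + 1) comparisons.
    · obtain ⟨H, hH⟩ := exists_halve b.els (by omega)
      refine ⟨H.bind fun r => done (p ++ ([⟨b.lev, r.1, r.2⟩, ⟨b.lev, b.top, b.els \ r.2⟩] ++ q)),
        fun v hv X hX hbu => ?_⟩
      simp only at hX hbu
      obtain ⟨h1, h2, h3, h4⟩ := hH v hv
      simp only [output_bind, cost_bind, output_done, cost_done, add_zero]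
      obtain ⟨⟨y, L⟩, hr⟩ : ∃ r, r = H.output v := ⟨_, rfl⟩
      rw [← hr] at h1 h2 h3 ⊢
      simp only at h1 h2 h3 ⊢
      have hL : L ⊆ b.els := by rw [h2]; exact Finset.filter_subset _ _
      have hc : (b.els \ L).card = b.els.card - L.card := Finset.card_sdiff_of_subset hL
      have hgt : ∀ z ∈ b.els \ L, v y < v z := by
        intro z hz
        rw [Finset.mem_sdiff, h2, Finset.mem_filter] at hz
        by_contra h
        exact hz.2 ⟨hz.1, by omega⟩
      have hle : ∀ z ∈ L, v z ≤ v y := by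
        intro z hz
        rw [h2, Finset.mem_filter] at hz
        exact hz.2
      obtain ⟨z, hz⟩ := Finset.card_pos.1 (show 0 < (b.els \ L).card by omega)
      have htop : b.top ∈ b.els \ L := by
        rw [Finset.mem_sdiff]
        refine ⟨hX.top_mem b (by simp), fun h => ?_⟩
        have h5 := hle _ h
        have h6 := hgt z hz
        have h7 := hX.le_top b (by simp) z (Finset.mem_sdiff.1 hz).1
        omega
      refine ⟨hX.replace ?_, Or.inr ⟨_, _, rfl, rfl, rfl, by simp only; omega, by simp only; omega,
        by simp only; omega, by simp only; omega, by rw [show u + 1 = b.els.card by omega]; exact h4⟩⟩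
      have := IsLayout.append (bs := [_]) (isLayout_singleton (b := ⟨b.lev, y, L⟩) h1 hle)
        (isLayout_singleton (b := ⟨b.lev, b.top, b.els \ L⟩) htop
          fun z hz => hX.le_top b (by simp) z (Finset.mem_sdiff.1 hz).1)
        fun z hz w hw => (hle z hz).trans_lt (hgt w hw)
      rwa [Finset.union_sdiff_of_subset hL] at this
    · exact ⟨done (p ++ b :: q), fun v _ X hX _ => ⟨hX, Or.inl ⟨rfl, hb, rfl⟩⟩⟩
  choose U hU using hsplit
  refine ⟨T.bind U, fun v hv X hX => ?_⟩
  obtain ⟨p, b, q, b', e1, e2, e3, e4, h5, h6⟩ := hT v X hX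
  have hcard : b'.els.card ≤ u + 1 := by
    rw [e4]
    exact (Finset.card_insert_le _ _).trans (by have := hbs.card_le b (by simp [e1]); omega)
  have hcard' : b.els.card ≤ b'.els.card := by
    rw [e4]; exact Finset.card_le_card (Finset.subset_insert _ _)
  have hlev : b.lev = t := hbs.lev_eq b (by simp [e1])
  have hlen : bs.length = p.length + q.length + 1 := by simp [e1]; omega
  obtain ⟨h7, h8⟩ := hU (T.output v) v hv (insert x X) (by rw [e2]; exact h5) (by rw [e2]; exact hcard)
  simp only [output_bind, cost_bind]
  refine ⟨h7, ?_⟩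
  have hmem : ∀ c, c ∈ p ∨ c ∈ q → c ∈ bs := by
    intro c hc; rw [e1]; simp only [List.mem_append, List.mem_cons]; tauto
  rw [e2] at h8 ⊢
  generalize (U (p, b', q)).output v = o at h8 ⊢
  simp only at h8
  rcases h8 with ⟨rfl, h9, h10⟩ | ⟨c, d, rfl, hc1, hd1, hc2, hd2, hc3, hd3, h10⟩
  · refine ⟨⟨by simp, ?_, ?_, ?_⟩, ?_⟩
    · intro c hc
      simp only [List.mem_append, List.mem_cons] at hc
      rcases hc with hc | rfl | hc
      exacts [hbs.lev_eq c (hmem c (by simp [hc])), e3.trans hlev, hbs.lev_eq c (hmem c (by simp [hc]))]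
    · intro c hc
      simp only [List.mem_append, List.mem_cons] at hc
      rcases hc with hc | rfl | hc
      exacts [hbs.card_le c (hmem c (by simp [hc])), h9, hbs.card_le c (hmem c (by simp [hc]))]
    · rcases hbs.half_full with h | h
      · left; simp; omega
      · right
        intro c hc
        simp only [List.mem_append, List.mem_cons] at hc
        rcases hc with hc | rfl | hc
        · exact h c (hmem c (by simp [hc]))
        · have := h b (by simp [e1]); omega
        · exact h c (hmem c (by simp [hc]))
    · rw [h10, hlen]
      simp only [List.length_append, List.length_cons, ← add_assoc, add_zero]
      omega
  · refine ⟨⟨by simp, ?_, ?_, ?_⟩, ?_⟩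
    · intro a ha
      simp only [List.mem_append, List.mem_cons, List.not_mem_nil, or_false] at ha
      rcases ha with ha | (rfl | rfl) | ha
      exacts [hbs.lev_eq a (hmem a (by simp [ha])), hc1.trans (e3.trans hlev),
        hd1.trans (e3.trans hlev), hbs.lev_eq a (hmem a (by simp [ha]))]
    · intro a ha
      simp only [List.mem_append, List.mem_cons, List.not_mem_nil, or_false] at ha
      rcases ha with ha | (rfl | rfl) | ha
      exacts [hbs.card_le a (hmem a (by simp [ha])), hc2, hd2, hbs.card_le a (hmem a (by simp [ha]))]
    · right
      intro a ha
      simp only [List.mem_append, List.mem_cons, List.not_mem_nil, or_false] at ha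
      rcases hbs.half_full with h | h
      · have hp : p = [] := List.eq_nil_of_length_eq_zero (by omega)
        have hq : q = [] := List.eq_nil_of_length_eq_zero (by omega)
        subst hp hq
        simp only [List.not_mem_nil, false_or, or_false] at ha
        rcases ha with rfl | rfl <;> assumption
      · rcases ha with ha | (rfl | rfl) | ha
        exacts [h a (hmem a (by simp [ha])), hc3, hd3, h a (hmem a (by simp [ha]))]
    · rw [hlen]
      simp only [List.length_append, List.length_cons, List.length_nil]
      have : 71 * (u + 1) * (p.length + (0 + 1 + 1 + q.length)) =
        71 * (u + 1) * (p.length + q.length + 1) + 71 * (u + 1) := by ring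
      omega

/-- Inserting many elements into a bucketing. -/
theorem exists_insertAll {t u j m : ℕ} (hu : 1 ≤ u) (hj : 1 ≤ j) (hm : 3 * m < 2 ^ j * (u + 1))
    (bs : List (Block ι)) (Y : Finset ι) :
    ∃ T : CompTree ι (List (Block ι)), ∀ v : ι → ℕ, Function.Injective v →
      ∀ X, IsLayout v bs X → IsBucketing t u bs → (Y ∪ X).card ≤ m →
      IsLayout v (T.output v) (Y ∪ X) ∧ IsBucketing t u (T.output v) ∧
      T.cost v + 71 * (u + 1) * bs.length ≤ Y.card * j + 71 * (u + 1) * (T.output v).length := by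
  induction Y using Finset.induction_on with
  | empty => exact ⟨done bs, fun v _ X h h' _ => by simp [h, h']⟩
  | insert a Y ha ih =>
    obtain ⟨T, hT⟩ := ih
    have hstep : ∀ cs : List (Block ι), ∃ U : CompTree ι (List (Block ι)), ∀ v : ι → ℕ,
        Function.Injective v → ∀ Z, IsLayout v cs Z → IsBucketing t u cs → Z.card ≤ m →
        IsLayout v (U.output v) (insert a Z) ∧ IsBucketing t u (U.output v) ∧
        U.cost v + 71 * (u + 1) * cs.length ≤ j + 71 * (u + 1) * (U.output v).length := by
      intro cs
      by_cases h : IsBucketing t u cs ∧ cs.length < 2 ^ j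
      · obtain ⟨U, hU⟩ := exists_insert hu cs a h.1 h.2
        exact ⟨U, fun v hv Z hZ _ _ => hU v hv Z hZ⟩
      · refine ⟨done [], fun v _ Z hZ hcs hZm => absurd ⟨hcs, ?_⟩ h⟩
        rcases hcs.length_mul_le hZ with h1 | h1
        · rw [h1]; exact Nat.one_lt_two_pow (by omega)
        · exact Nat.lt_of_mul_lt_mul_right (a := u + 1) (by omega)
    choose U hU using hstep
    refine ⟨T.bind U, fun v hv X hX hbs hcard => ?_⟩
    rw [Finset.insert_union] at hcard ⊢
    have hcard' := (Finset.card_le_card (Finset.subset_insert a (Y ∪ X))).trans hcard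
    obtain ⟨h1, h2, h3⟩ := hT v hv X hX hbs hcard'
    obtain ⟨h4, h5, h6⟩ := hU _ v hv _ h1 h2 hcard'
    simp only [output_bind, cost_bind]
    refine ⟨h4, h5, ?_⟩
    rw [Finset.card_insert_of_notMem ha, show (Y.card + 1) * j = Y.card * j + j by ring]
    omega

/-- A set of `m` elements can be cut into consecutive blocks of at most `u` elements with
`m (log₂ (m / u) + O(1))` comparisons. -/
theorem exists_split {u j : ℕ} (t : ℕ) (hu : 1 ≤ u) (X : Finset ι) (hX : X.Nonempty)
    (hj : X.card < 2 ^ j * (u + 1)) :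
    ∃ T : CompTree ι (List (Block ι)), ∀ v : ι → ℕ, Function.Injective v →
      IsLayout v (T.output v) X ∧ (∀ b ∈ T.output v, b.lev = t ∧ b.els.card ≤ u) ∧
      T.cost v ≤ X.card * (j + 215) := by
  obtain ⟨a, ha⟩ := hX
  -- When there are several buckets, their number is at most 3m/(u + 1) < 2^(j+2), so an insertion
  -- takes j + 2 comparisons.
  obtain ⟨T, hT⟩ := exists_insertAll (t := t) (j := j + 2) (m := X.card) hu (by omega)
    (by rw [pow_add, mul_right_comm]; omega) [⟨t, a, {a}⟩] (X.erase a)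
  refine ⟨T, fun v hv => ?_⟩
  have e : X.erase a ∪ {a} = X := by
    rw [Finset.union_comm, ← Finset.insert_eq, Finset.insert_erase ha]
  have hl : IsLayout v [⟨t, a, {a}⟩] ({a} : Finset ι) :=
    isLayout_singleton (b := ⟨t, a, {a}⟩) (by simp) (by simp)
  obtain ⟨h1, h2, h3⟩ := hT v hv {a} hl ⟨by simp, by simp, by simpa using hu, Or.inl rfl⟩
    (by rw [e])
  rw [e] at h1
  refine ⟨h1, fun b hb => ⟨h2.lev_eq b hb, h2.card_le b hb⟩, ?_⟩
  have h4 : (X.erase a).card * (j + 2) ≤ X.card * (j + 2) :=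
    Nat.mul_le_mul_right _ (Finset.card_le_card (Finset.erase_subset _ _))
  -- Here 213 = 3 · 71: several final buckets together hold at most 3m/(u + 1) charges of 71 (u +
  -- 1). A single one cancels against the initial bucket.
  rw [show X.card * (j + 215) = X.card * (j + 2) + 213 * X.card by ring]
  rcases h2.length_mul_le h1 with h5 | h5
  · rw [h5] at h3
    simp only [List.length_singleton] at h3
    omega
  · have : 71 * (u + 1) * (T.output v).length = 71 * ((T.output v).length * (u + 1)) := by ring
    rw [this] at h3
    omega

end Layout

end Multiselection

/-! ### Potential, invariant and refinement of blocks -/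

namespace Multiselection

open CompTree

/-- `∑_{i ≤ t} i`: a block of level `t` has at most `n / 2 ^ depth t` elements. -/
def depth : ℕ → ℕ
  | 0 => 0
  | t + 1 => depth t + (t + 1)

/-- The number of comparisons per element that are charged to a block of level `t`. -/
def weight (t : ℕ) : ℕ := depth t + 216 * t

/-- Comparisons charged to a list of blocks. -/
def potential {ι : Type} (bs : List (Block ι)) : ℕ :=
  (bs.map fun b => b.els.card * weight b.lev).sum

/-- Distance of the element with `a` predecessors from the cut after the first `s` elements. -/
def cutDist (a s : ℕ) : ℕ := if s ≤ a then a - s + 1 else s - a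

section Potential

variable {ι : Type}

theorem potential_append (bs cs : List (Block ι)) :
    potential (bs ++ cs) = potential bs + potential cs := by
  simp [potential]

theorem potential_cons (b : Block ι) (cs : List (Block ι)) :
    potential (b :: cs) = b.els.card * weight b.lev + potential cs := by
  simp [potential]

theorem potential_of_lev_eq {bs : List (Block ι)} {t : ℕ} (h : ∀ b ∈ bs, b.lev = t) :
    potential bs = totalCard bs * weight t := by
  induction bs with
  | nil => simp [potential, totalCard]
  | cons b bs ih =>
    rw [potential_cons, totalCard_cons, ih fun c hc => h c (by simp [hc]), h b (by simp), add_mul]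

theorem exists_block_of_lt {bs : List (Block ι)} : ∀ {r : ℕ}, r < totalCard bs →
    ∃ p b q, bs = p ++ b :: q ∧ totalCard p ≤ r ∧ r < totalCard p + b.els.card := by
  induction bs with
  | nil => intro r h; simp [totalCard] at h
  | cons b bs ih =>
    intro r h
    rw [totalCard_cons] at h
    rcases Nat.lt_or_ge r b.els.card with hr | hr
    · exact ⟨[], b, bs, rfl, by simp [totalCard], by simpa [totalCard] using hr⟩
    · obtain ⟨p, c, q, rfl, h1, h2⟩ := ih (r := r - b.els.card) (by omega)
      exact ⟨b :: p, c, q, rfl, by rw [totalCard_cons]; omega, by rw [totalCard_cons]; omega⟩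

end Potential

section State

variable {n : ℕ}

/-- The values of a permutation as natural numbers. -/
abbrev rankFun (e : Equiv.Perm (Fin n)) : Fin n → ℕ := fun x => (e x : ℕ)

theorem rankFun_injective (e : Equiv.Perm (Fin n)) : Function.Injective (rankFun e) :=
  fun _ _ h => e.injective (Fin.ext h)

theorem card_filter_rankFun_lt (e : Equiv.Perm (Fin n)) (x : Fin n) :
    (Finset.univ.filter fun y => rankFun e y < rankFun e x).card = rankFun e x := by
  have : (Finset.univ.filter fun y => rankFun e y < rankFun e x) =
      (Finset.Iio (e x)).map e.symm.toEmbedding := by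
    ext y
    simp [rankFun, Finset.mem_map_equiv]
  rw [this, Finset.card_map, Fin.card_Iio]

theorem card_filter_rankFun_le (e : Equiv.Perm (Fin n)) (x : Fin n) :
    (Finset.univ.filter fun y => rankFun e y ≤ rankFun e x).card = rankFun e x + 1 :=
  HasRank.card_le (rankFun_injective e) ⟨Finset.mem_univ x, card_filter_rankFun_lt e x⟩

theorem IsLayout.rank_mem {e : Equiv.Perm (Fin n)} {p q : List (Block (Fin n))}
    {b : Block (Fin n)} (h : IsLayout (rankFun e) (p ++ b :: q) Finset.univ) {x : Fin n}
    (hx : x ∈ b.els) :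
    totalCard p ≤ rankFun e x ∧ rankFun e x < totalCard p + b.els.card := by
  obtain ⟨P, Y, hPY', hP, hY, hPY⟩ := h.of_append
  obtain ⟨B, Q, rfl, hB, hQ, hBQ⟩ := IsLayout.of_append (bs := [b]) hY
  obtain rfl := hB.of_singleton
  rw [hP.totalCard_eq]
  constructor
  · rw [← card_filter_rankFun_lt e x]
    refine Finset.card_le_card fun y hy => ?_
    exact Finset.mem_filter.2 ⟨Finset.mem_univ y, hPY y hy x (by simp [hx])⟩
  · rw [← Nat.add_one_le_iff, ← card_filter_rankFun_le e x]
    refine le_trans (Finset.card_le_card fun y hy => ?_) (Finset.card_union_le P b.els)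
    have hy' : y ∈ P ∪ (b.els ∪ Q) := hPY' ▸ Finset.mem_univ y
    simp only [Finset.mem_union] at hy' ⊢
    rcases hy' with h1 | h1 | h1
    · exact Or.inl h1
    · exact Or.inr h1
    · exact absurd (hBQ x hx y h1) (not_lt.2 (Finset.mem_filter.1 hy).2)

/-- The invariant of the online algorithm: `bs` is a layout whose blocks are as small as their level
demands, and all blocks that were split were close to a requested rank. -/
structure Invariant (e : Equiv.Perm (Fin n)) (S : List ℕ) (bs : List (Block (Fin n))) : Prop where
  layout : IsLayout (rankFun e) bs Finset.univ
  small : ∀ b ∈ bs, b.els.card ≤ 1 ∨ b.els.card * 2 ^ depth b.lev ≤ n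
  close : ∀ b ∈ bs, ∀ t, b.lev = t + 1 → ∀ x ∈ b.els,
    ∃ s ∈ S, cutDist (rankFun e x) s * 2 ^ depth t ≤ n

/-- The cut `s` meets the block, possibly at an end, so all elements of the block are within its
size of `s`; this gives closeness one level up. The size bound persists because pieces shrink by the
factor by which 2 ^ `depth` grows, unless they are singletons. -/
theorem Invariant.replace {e : Equiv.Perm (Fin n)} {S : List ℕ} {p q bs : List (Block (Fin n))}
    {b : Block (Fin n)} (h : Invariant e S (p ++ b :: q)) (hb : 2 ≤ b.els.card)
    (hbs : IsLayout (rankFun e) bs b.els)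
    (hc : ∀ c ∈ bs, c.lev = b.lev + 1 ∧ c.els.card ≤ max 1 (b.els.card / 2 ^ (b.lev + 1)))
    {s : ℕ} (hs : s ∈ S) (hs1 : totalCard p ≤ s) (hs2 : s ≤ totalCard p + b.els.card) :
    Invariant e S (p ++ (bs ++ q)) := by
  have hsm : b.els.card * 2 ^ depth b.lev ≤ n := (h.small b (by simp)).resolve_left (by omega)
  refine ⟨h.layout.replace hbs, ?_, ?_⟩
  · intro c hc'
    simp only [List.mem_append] at hc'
    rcases hc' with h1 | h1 | h1
    · exact h.small c (by simp [h1])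
    · obtain ⟨h2, h3⟩ := hc c h1
      rcases le_max_iff.1 h3 with h4 | h4
      · exact Or.inl h4
      · right
        rw [h2, depth, pow_add, mul_comm (2 ^ depth b.lev), ← mul_assoc]
        refine le_trans (Nat.mul_le_mul_right _ ?_) hsm
        exact (Nat.mul_le_mul_right _ h4).trans (Nat.div_mul_le_self _ _)
    · exact h.small c (by simp [h1])
  · intro c hc' t ht x hx
    simp only [List.mem_append] at hc'
    rcases hc' with h1 | h1 | h1
    · exact h.close c (by simp [h1]) t ht x hx
    · have hxb : x ∈ b.els := (hbs.mem_iff x).2 ⟨c, h1, hx⟩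
      have htb : t = b.lev := by have := (hc c h1).1; omega
      have hr := h.layout.rank_mem hxb
      refine ⟨s, hs, ?_⟩
      rw [htb]
      refine le_trans (Nat.mul_le_mul_right _ ?_) hsm
      unfold cutDist
      split_ifs <;> omega
    · exact h.close c (by simp [h1]) t ht x hx

/-- Repeated splitting isolates the element of rank `r`. -/
theorem exists_refine (m : ℕ) : ∀ (p : List (Block (Fin n))) (b : Block (Fin n))
    (q : List (Block (Fin n))) (r : ℕ), b.els.card = m → totalCard p ≤ r →
    r < totalCard p + b.els.card →
    ∃ T : CompTree (Fin n) (Fin n × List (Block (Fin n))), ∀ (e : Equiv.Perm (Fin n)) (S : List ℕ),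
      (r ∈ S ∨ r + 1 ∈ S) → Invariant e S (p ++ b :: q) →
      rankFun e (T.output (rankFun e)).1 = r ∧ Invariant e S (T.output (rankFun e)).2 ∧
      T.cost (rankFun e) + potential (p ++ b :: q) + m ≤
        potential (T.output (rankFun e)).2 + 1 := by
  induction m using Nat.strong_induction_on with
  | _ m ih =>
    intro p b q r hm hr1 hr2
    obtain ⟨x, hx⟩ := Finset.card_pos.1 (show 0 < b.els.card by omega)
    rcases Nat.lt_or_ge m 2 with hm2 | hm2
    -- A singleton needs no split and hence yields no slack; the `+ 1` in the bound makes up for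
    -- this.
    · refine ⟨done (x, p ++ b :: q), fun e S _ h => ⟨?_, h, ?_⟩⟩
      · have := h.layout.rank_mem hx
        simp only [output_done]
        omega
      · simp only [output_done, cost_done]; omega
    · set u := max 1 (b.els.card / 2 ^ (b.lev + 1)) with hu
      have hj : b.els.card < 2 ^ (b.lev + 1) * (u + 1) :=
        (Nat.lt_mul_div_succ b.els.card (by positivity)).trans_le
          (Nat.mul_le_mul_left _ (Nat.succ_le_succ (le_max_right _ _)))
      have hum : u < m := by
        refine max_lt (by omega) ?_
        rw [hm]
        exact Nat.div_lt_self (by omega) (Nat.one_lt_two_pow (by omega))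
      obtain ⟨T, hT⟩ := exists_split (b.lev + 1) (le_max_left _ _) b.els ⟨x, hx⟩ hj
      have hstep : ∀ bs : List (Block (Fin n)),
          ∃ U : CompTree (Fin n) (Fin n × List (Block (Fin n))),
          ∀ (e : Equiv.Perm (Fin n)) (S : List ℕ), (r ∈ S ∨ r + 1 ∈ S) → totalCard bs = m →
          (∀ c ∈ bs, c.els.card ≤ u) → Invariant e S (p ++ (bs ++ q)) →
          rankFun e (U.output (rankFun e)).1 = r ∧ Invariant e S (U.output (rankFun e)).2 ∧
          U.cost (rankFun e) + potential (p ++ (bs ++ q)) ≤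
            potential (U.output (rankFun e)).2 := by
        intro bs
        by_cases hbs : totalCard bs = m ∧ ∀ c ∈ bs, c.els.card ≤ u
        · obtain ⟨p', c, q', rfl, h1, h2⟩ :=
            exists_block_of_lt (bs := bs) (r := r - totalCard p) (by omega)
          have hc := hbs.2 c (by simp)
          obtain ⟨U, hU⟩ := ih c.els.card (by omega) (p ++ p') c (q' ++ q) r rfl
            (by rw [totalCard_append]; omega) (by rw [totalCard_append]; omega)
          refine ⟨U, fun e S hS _ _ hI => ?_⟩
          have e1 : p ++ (p' ++ c :: q' ++ q) = p ++ p' ++ c :: (q' ++ q) := by simp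
          rw [e1] at hI ⊢
          obtain ⟨h3, h4, h5⟩ := hU e S hS hI
          exact ⟨h3, h4, by omega⟩
        · exact ⟨done (x, []), fun _ _ _ h h' => absurd ⟨h, h'⟩ hbs⟩
      choose U hU using hstep
      refine ⟨T.bind U, fun e S hS hI => ?_⟩
      obtain ⟨h1, h2, h3⟩ := hT (rankFun e) (rankFun_injective e)
      -- A selection that isolates the element with `r` predecessors has rank r + 1; a search has
      -- rank r or r + 1. Both cuts touch the block.
      obtain ⟨s, hs, hs'⟩ : ∃ s ∈ S, s = r ∨ s = r + 1 := by
        rcases hS with h | h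
        exacts [⟨r, h, Or.inl rfl⟩, ⟨r + 1, h, Or.inr rfl⟩]
      have h4 := hI.replace (by omega) h1 h2 hs (by omega) (by omega)
      obtain ⟨h5, h6, h7⟩ := hU _ e S hS (h1.totalCard_eq.trans hm) (fun c hc => (h2 c hc).2) h4
      simp only [output_bind, cost_bind]
      refine ⟨h5, h6, ?_⟩
      rw [potential_append, potential_append, potential_of_lev_eq fun c hc => (h2 c hc).1,
        h1.totalCard_eq] at h7
      rw [potential_append, potential_cons]
      -- The split uses all but one unit per element of the increase in weight. The unit left over
      -- at the first split is the summand `m` of the bound.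
      have hw : b.els.card * weight (b.lev + 1) =
          b.els.card * weight b.lev + b.els.card * (b.lev + 1 + 215) + b.els.card := by
        simp only [weight, depth]; ring
      omega

theorem exists_select (bs : List (Block (Fin n))) (r : Fin n) :
    ∃ T : CompTree (Fin n) (Fin n × List (Block (Fin n))), ∀ (e : Equiv.Perm (Fin n)) (S : List ℕ),
      (r : ℕ) + 1 ∈ S → Invariant e S bs →
      rankFun e (T.output (rankFun e)).1 = r ∧ Invariant e S (T.output (rankFun e)).2 ∧
      T.cost (rankFun e) + potential bs ≤ potential (T.output (rankFun e)).2 := by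
  by_cases h : (r : ℕ) < totalCard bs
  · obtain ⟨p, b, q, rfl, h1, h2⟩ := exists_block_of_lt h
    obtain ⟨T, hT⟩ := exists_refine b.els.card p b q r rfl h1 h2
    refine ⟨T, fun e S hS hI => ?_⟩
    obtain ⟨h3, h4, h5⟩ := hT e S (Or.inr hS) hI
    exact ⟨h3, h4, by omega⟩
  · refine ⟨done (r, []), fun e S _ hI => absurd ?_ h⟩
    rw [hI.layout.totalCard_eq, Finset.card_univ, Fintype.card_fin]
    exact r.2

end State

/-! ### Reduction of arrays with repetitions to permutations -/

section Ties

variable {n : ℕ} {α : Type*} [LinearOrder α]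

/-- The permutation that maps each index to its rank; equal elements are ranked by index. -/
def ranking (A : Fin n → α) : Equiv.Perm (Fin n) := (Tuple.sort A).symm

theorem le_of_ranking_le {A : Fin n → α} {x y : Fin n} (h : ranking A x ≤ ranking A y) :
    A x ≤ A y := by
  have := Tuple.monotone_sort A h
  simpa [ranking] using this

theorem ranking_lt_of_lt {A : Fin n → α} {x y : Fin n} (h : A x < A y) :
    ranking A x < ranking A y := by
  by_contra hc
  exact absurd (le_of_ranking_le (not_lt.1 hc)) (not_le.2 h)

theorem ranking_le_iff {A : Fin n → α} {x y : Fin n} (hxy : x ≤ y) :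
    ranking A x ≤ ranking A y ↔ A x ≤ A y := by
  refine ⟨le_of_ranking_le, fun h => ?_⟩
  rcases h.lt_or_eq with h | h
  · exact (ranking_lt_of_lt h).le
  · by_contra hc
    have h2 := ((Tuple.eq_sort_iff (f := A) (σ := Tuple.sort A)).1 rfl).2 (ranking A y)
      (ranking A x) (not_le.1 hc)
    simp only [ranking, Equiv.apply_symm_apply] at h2
    have h3 := h2 h.symm
    exact absurd hxy (not_le.2 h3)

/-- Ask for `y ≤ x` instead of `x ≤ y` if `y < x` as indices. Thus equal elements are treated as
if they were ordered by index. -/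
def CompTree.tieBreak {β : Type} : CompTree (Fin n) β → CompTree (Fin n) β
  | done b => done b
  | cmp x y t e => if x ≤ y then cmp x y t.tieBreak e.tieBreak else cmp y x e.tieBreak t.tieBreak

/-- If y precedes x as an index, then x is ranked above y exactly when A y ≤ A x, so the reversed
question with swapped branches answers the original one on ranks. Trees on array elements thus need
analysis only on permutations. -/
theorem CompTree.tieBreak_spec {β : Type} (A : Fin n → α) (T : CompTree (Fin n) β) :
    T.tieBreak.output A = T.output (rankFun (ranking A)) ∧
      T.tieBreak.cost A = T.cost (rankFun (ranking A)) := by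
  induction T with
  | done b => exact ⟨rfl, rfl⟩
  | cmp x y t e iht ihe =>
    by_cases hxy : x ≤ y
    · have h : rankFun (ranking A) x ≤ rankFun (ranking A) y ↔ A x ≤ A y := ranking_le_iff hxy
      simp only [tieBreak, if_pos hxy, output, cost, h, iht, ihe, and_self]
    · have h : ¬ rankFun (ranking A) x ≤ rankFun (ranking A) y ↔ A y ≤ A x := by
        rw [← ranking_le_iff (not_le.1 hxy).le, not_le]
        refine ⟨fun h => Fin.le_def.2 (le_of_lt h), fun h => lt_of_le_of_ne (Fin.le_def.1 h) ?_⟩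
        intro h'
        exact hxy (rankFun_injective _ h').ge
      simp only [tieBreak, if_neg hxy, output, cost, ← h, iht, ihe]
      split_ifs <;> simp_all

/-- By its rank, `x` is the first element not below the key, so the key occurs in the array if and
only if it equals A x. -/
theorem searchPosition_eq {A : Fin n → α} {key : α} {x : Fin n}
    (hx : rankFun (ranking A) x = (Finset.univ.filter fun i => A i < key).card) :
    searchPosition A key = if A x ≤ key then rankFun (ranking A) x + 1
      else rankFun (ranking A) x := by
  have h1 : key ≤ A x := by
    by_contra hc
    have h2 : (Finset.univ.filter fun y => rankFun (ranking A) y ≤ rankFun (ranking A) x) ⊆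
        Finset.univ.filter fun i => A i < key := fun y hy => by
      rw [Finset.mem_filter] at hy ⊢
      exact ⟨hy.1, (le_of_ranking_le (Fin.le_def.2 hy.2)).trans_lt (not_le.1 hc)⟩
    have := Finset.card_le_card h2
    rw [card_filter_rankFun_le] at this
    omega
  have h3 : (∃ i, A i = key) ↔ A x ≤ key := by
    constructor
    · rintro ⟨i, rfl⟩
      by_contra hc
      have h4 : ranking A i < ranking A x := ranking_lt_of_lt (not_le.1 hc)
      have h5 : (Finset.univ.filter fun y => A y < A i) ⊆
          Finset.univ.filter fun y => rankFun (ranking A) y < rankFun (ranking A) i :=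
        fun y hy => by
          rw [Finset.mem_filter] at hy ⊢
          exact ⟨hy.1, ranking_lt_of_lt hy.2⟩
      have := Finset.card_le_card h5
      rw [card_filter_rankFun_lt, ← hx] at this
      exact absurd (Fin.lt_def.1 h4) (not_lt.2 this)
    · exact fun h => ⟨x, le_antisymm h h1⟩
  simp only [searchPosition, h3, ← hx]

end Ties

/-! ### Searches -/

section Search

variable {n : ℕ}

/-- Serving a search: binary search for the block, comparison of the key with its elements, and
isolation of the element found. -/
theorem exists_search (bs : List (Block (Fin n))) :
    ∃ T : CompTree (Option (Fin n)) (ℕ × List (Block (Fin n))),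
      ∀ (α : Type u) [LinearOrder α] (A : Fin n → α) (key : α) (S : List ℕ),
      searchPosition A key ∈ S → Invariant (ranking A) S bs →
      (T.output (withKey A key)).1 = searchPosition A key ∧
      Invariant (ranking A) S (T.output (withKey A key)).2 ∧
      T.cost (withKey A key) + potential bs ≤
        potential (T.output (withKey A key)).2 + (Nat.log 2 n + 3) := by
  -- Always true under the invariant: blocks are nonempty, so there are at most n of them.
  by_cases hlen : bs.length < 2 ^ (Nat.log 2 n + 1)
  swap
  · refine ⟨done (0, []), fun α _ A key S _ hI => absurd ?_ hlen⟩
    have := hI.layout.length_mul_le (w := 1) fun b hb =>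
      Finset.card_pos.2 ⟨_, hI.layout.top_mem b hb⟩
    rw [Finset.card_univ, Fintype.card_fin] at this
    exact lt_of_le_of_lt (by omega) (Nat.lt_pow_succ_log_self (by norm_num) n)
  obtain ⟨T, hT⟩ := exists_binarySearch.{u} (fun b : Block (Fin n) => some b.top) none _ bs hlen
  have hblock : ∀ (p : List (Block (Fin n))) (b : Block (Fin n)) (q : List (Block (Fin n))),
      ∃ U : CompTree (Option (Fin n)) (ℕ × List (Block (Fin n))),
      ∀ (α : Type u) [LinearOrder α] (A : Fin n → α) (key : α) (S : List ℕ),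
      searchPosition A key ∈ S → Invariant (ranking A) S (p ++ b :: q) →
      (∀ c ∈ p, A c.top < key) → key ≤ A b.top →
      (U.output (withKey A key)).1 = searchPosition A key ∧
      Invariant (ranking A) S (U.output (withKey A key)).2 ∧
      U.cost (withKey A key) + potential (p ++ b :: q) ≤
        potential (U.output (withKey A key)).2 + 2 := by
    intro p b q
    obtain ⟨F, hF⟩ := exists_filter.{u} (ι := Option (Fin n)) b.els (fun _ => none) some
    have hrefine : ∀ r : ℕ, ∃ R : CompTree (Option (Fin n)) (ℕ × List (Block (Fin n))),
        ∀ (α : Type u) [LinearOrder α] (A : Fin n → α) (key : α) (S : List ℕ),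
        searchPosition A key ∈ S → Invariant (ranking A) S (p ++ b :: q) →
        totalCard p ≤ r → r < totalCard p + b.els.card →
        r = (Finset.univ.filter fun i => A i < key).card →
        (R.output (withKey A key)).1 = searchPosition A key ∧
        Invariant (ranking A) S (R.output (withKey A key)).2 ∧
        R.cost (withKey A key) + potential (p ++ b :: q) + b.els.card ≤
          potential (R.output (withKey A key)).2 + 2 := by
      intro r
      by_cases hr : totalCard p ≤ r ∧ r < totalCard p + b.els.card
      · obtain ⟨V, hV⟩ := exists_refine b.els.card p b q r rfl hr.1 hr.2
        -- One last comparison decides whether the key occurs; with the `+ 1` of `exists_refine` it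
        -- makes `+ 2`.
        refine ⟨(V.tieBreak.mapItems some).bind fun o =>
          cmp (some o.1) none (done (r + 1, o.2)) (done (r, o.2)),
          fun α _ A key S hS hI _ _ hrc => ?_⟩
        have hcomp : withKey A key ∘ some = A := rfl
        simp only [output_bind, cost_bind, output_mapItems, cost_mapItems, hcomp,
          (tieBreak_spec A V).1, (tieBreak_spec A V).2]
        have hrS : r ∈ S ∨ r + 1 ∈ S := by
          rw [searchPosition, ← hrc] at hS
          split_ifs at hS
          exacts [Or.inr hS, Or.inl hS]
        obtain ⟨h1, h2, h3⟩ := hV (ranking A) S hrS hI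
        have h4 := searchPosition_eq (key := key) (h1.trans hrc)
        rw [h1] at h4
        by_cases h5 : withKey A key (some (V.output (rankFun (ranking A))).1) ≤ withKey A key none
        · have h6 := h4.trans (if_pos h5)
          simp only [output, cost, if_pos h5]
          exact ⟨h6.symm, h2, by omega⟩
        · have h6 := h4.trans (if_neg h5)
          simp only [output, cost, if_neg h5]
          exact ⟨h6.symm, h2, by omega⟩
      · exact ⟨done (0, []), fun α _ A key S _ _ h h' => absurd ⟨h, h'⟩ hr⟩
    choose R hR using hrefine
    -- `Y` consists of the elements of the block that are at least the key. Earlier blocks lie below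
    -- the key and later ones do not, so the argument of `R` counts the elements smaller than the
    -- key. The scan uses up the slack `b.els.card`.
    refine ⟨F.bind fun Y => R (totalCard p + (b.els.card - Y.card)),
      fun α _ A key S hS hI hp hb => ?_⟩
    obtain ⟨h1, h2⟩ := hF α (withKey A key)
    simp only [output_bind, cost_bind]
    set Y := F.output (withKey A key) with hY
    have hYmem : ∀ x, x ∈ Y ↔ x ∈ b.els ∧ key ≤ A x := fun x => by
      rw [h1]; exact Finset.mem_filter
    have hYb : Y ⊆ b.els := fun x hx => ((hYmem x).1 hx).1
    have hbY : b.top ∈ Y := (hYmem _).2 ⟨hI.layout.top_mem b (by simp), hb⟩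
    have hY1 : 0 < Y.card := Finset.card_pos.2 ⟨_, hbY⟩
    have hY2 : Y.card ≤ b.els.card := Finset.card_le_card hYb
    have hcount : totalCard p + (b.els.card - Y.card) =
        (Finset.univ.filter fun i => A i < key).card := by
      obtain ⟨P, Z, hPZ', hP, hZ, hPZ⟩ := hI.layout.of_append
      obtain ⟨B, Q, rfl, hB, hQ, hBQ⟩ := IsLayout.of_append (bs := [b]) hZ
      obtain rfl := hB.of_singleton
      have e1 : (Finset.univ.filter fun i => A i < key) = P ∪ (b.els \ Y) := by
        ext x
        simp only [Finset.mem_filter, Finset.mem_univ, true_and, Finset.mem_union,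
          Finset.mem_sdiff, hYmem, not_and, not_le]
        constructor
        · intro hx
          have hx' : x ∈ P ∪ (b.els ∪ Q) := hPZ' ▸ Finset.mem_univ x
          simp only [Finset.mem_union] at hx'
          rcases hx' with h | h | h
          · exact Or.inl h
          · exact Or.inr ⟨h, fun _ => hx⟩
          · have h5 := hBQ b.top (hI.layout.top_mem b (by simp)) x h
            have h6 : A b.top ≤ A x := le_of_ranking_le (Fin.le_def.2 h5.le)
            exact absurd (hb.trans h6) (not_le.2 hx)
        · rintro (h | ⟨h, h'⟩)
          · obtain ⟨c, hc, hxc⟩ := (hP.mem_iff x).1 h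
            exact (le_of_ranking_le (Fin.le_def.2 (hP.le_top c hc x hxc))).trans_lt (hp c hc)
          · exact h' h
      rw [e1, Finset.card_union_of_disjoint, Finset.card_sdiff_of_subset hYb, hP.totalCard_eq]
      refine Finset.disjoint_left.2 fun x hx hx' => ?_
      exact (hPZ x hx x (by simp [(Finset.mem_sdiff.1 hx').1])).false
    obtain ⟨h3, h4, h5⟩ := hR _ α A key S hS hI (by omega) (by omega) hcount
    exact ⟨h3, h4, by omega⟩
  choose U hU using hblock
  refine ⟨T.bind fun o => match o.2 with
    | [] => done (n, bs)
    | b :: q => U o.1 b q, fun α _ A key S hS hI => ?_⟩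
  obtain ⟨h1, h2, h3, h4⟩ := hT α (withKey A key)
    (hI.layout.pairwise_top.imp fun h => le_of_ranking_le (Fin.le_def.2 h))
  simp only [output_bind, cost_bind]
  obtain ⟨⟨p, q⟩, hr⟩ : ∃ r, r = T.output (withKey A key) := ⟨_, rfl⟩
  rw [← hr] at h1 h2 h3 ⊢
  simp only [withKey] at h1 h2 h3
  rcases q with _ | ⟨b, q⟩
  · simp only [List.append_nil] at h1
    subst h1
    have hall : ∀ i, A i < key := by
      intro i
      obtain ⟨c, hc, hic⟩ := (hI.layout.mem_iff i).1 (Finset.mem_univ i)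
      exact (le_of_ranking_le (Fin.le_def.2 (hI.layout.le_top c hc i hic))).trans_lt (h2 c hc)
    refine ⟨?_, hI, ?_⟩
    · rw [searchPosition, if_neg (by rintro ⟨i, hi⟩; exact (hall i).ne hi),
        Finset.filter_true_of_mem (fun i _ => hall i), Finset.card_univ, Fintype.card_fin]
      rfl
    · simp only [output_done, cost_done]
      omega
  · subst h1
    obtain ⟨h5, h6, h7⟩ := hU p b q α A key S hS hI h2 (h3 b (by simp))
    exact ⟨h5, h6, by simp only; omega⟩

end Search

/-! ### The online algorithm -/

section Algorithm

variable {n : ℕ}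

/-- The only preprocessing is to find the maximum, the top of the initial block. No block has been
split, so the invariant holds for every `S`. -/
theorem exists_init (n : ℕ) : ∃ T : CompTree (Fin n) (List (Block (Fin n))),
    ∀ e : Equiv.Perm (Fin n), (∀ S, Invariant e S (T.output (rankFun e))) ∧
      potential (T.output (rankFun e)) = 0 ∧ T.cost (rankFun e) ≤ n := by
  rcases Nat.eq_zero_or_pos n with rfl | hn
  · refine ⟨done [], fun e => ⟨fun S => ⟨?_, by simp, by simp⟩, rfl, le_rfl⟩⟩
    exact isLayout_nil
  · obtain ⟨T, hT⟩ := exists_max.{0} (Finset.univ : Finset (Fin n)) ⟨⟨0, hn⟩, Finset.mem_univ _⟩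
    refine ⟨T.bind fun x => done [⟨0, x, Finset.univ⟩], fun e => ?_⟩
    obtain ⟨h1, h2, h3⟩ := hT ℕ (rankFun e)
    simp only [output_bind, cost_bind, output_done, cost_done]
    refine ⟨fun S => ⟨?_, ?_, ?_⟩, ?_, by simpa using h3⟩
    · exact isLayout_singleton (b := ⟨0, _, Finset.univ⟩) h1 h2
    · simp [depth]
    · simp
    · simp [potential, weight, depth]

/-- The online algorithm. -/
noncomputable def onlineAlg (n : ℕ) : OnlineAlgorithm n where
  State := List (Block (Fin n))
  init := (exists_init n).choose.tieBreak
  select bs r := (exists_select bs r).choose.tieBreak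
  search bs := (exists_search.{u} bs).choose

/-- `S` may contain ranks of future queries, but it serves the analysis only: each tree is chosen
before `S` is quantified. The costs telescope against the potential. -/
theorem onlineAlg_run {α : Type u} [LinearOrder α] (A : Fin n → α) (S : List ℕ)
    (Q : List (Query n α)) : ∀ bs : List (Block (Fin n)), (∀ q ∈ Q, queryRank A q ∈ S) →
    Invariant (ranking A) S bs →
    List.Forall₂ (IsCorrect A) Q ((onlineAlg.{u} n).answersFrom A bs Q) ∧
    ∃ bs', Invariant (ranking A) S bs' ∧
      (onlineAlg.{u} n).costFrom A bs Q + potential bs ≤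
        potential bs' + searchCount Q * (Nat.log 2 n + 3) := by
  induction Q with
  | nil => exact fun bs _ h => ⟨List.Forall₂.nil, bs, h, by simp [OnlineAlgorithm.costFrom]⟩
  | cons q Q ih =>
    intro bs hS hI
    have hq := hS q (by simp)
    have hQ : ∀ q ∈ Q, queryRank A q ∈ S := fun q hq => hS q (by simp [hq])
    cases q with
    | select r =>
      obtain ⟨h1, h2, h3⟩ := (exists_select bs r).choose_spec (ranking A) S hq hI
      rw [← (tieBreak_spec A (exists_select bs r).choose).1] at h1 h2 h3
      rw [← (tieBreak_spec A (exists_select bs r).choose).2] at h3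
      obtain ⟨h4, bs', h5, h6⟩ := ih _ hQ h2
      refine ⟨List.Forall₂.cons ?_ h4, bs', h5, ?_⟩
      · change A ((exists_select bs r).choose.tieBreak.output A).1 = sorted A r
        rw [sorted, Function.comp_apply]
        congr 1
        rw [← Equiv.symm_apply_eq]
        exact Fin.ext h1
      · have e1 : searchCount (Query.select r :: Q : List (Query n α)) = searchCount Q :=
          List.countP_cons_of_neg (by simp [Query.isSearch])
        rw [e1]
        change (exists_select bs r).choose.tieBreak.cost A + (onlineAlg.{u} n).costFrom A
          ((exists_select bs r).choose.tieBreak.output A).2 Q + _ ≤ _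
        omega
    | search key =>
      obtain ⟨h1, h2, h3⟩ := (exists_search.{u} bs).choose_spec α A key S hq hI
      obtain ⟨h4, bs', h5, h6⟩ := ih _ hQ h2
      refine ⟨List.Forall₂.cons h1 h4, bs', h5, ?_⟩
      have e1 : searchCount (Query.search key :: Q : List (Query n α)) = searchCount Q + 1 :=
        List.countP_cons_of_pos rfl
      rw [e1, add_mul, one_mul]
      change (exists_search.{u} bs).choose.cost (withKey A key) + (onlineAlg.{u} n).costFrom A
        ((exists_search.{u} bs).choose.output (withKey A key)).2 Q + _ ≤ _
      omega

theorem onlineAlg_spec {α : Type u} [LinearOrder α] (A : Fin n → α) (Q : List (Query n α)) :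
    List.Forall₂ (IsCorrect A) Q ((onlineAlg.{u} n).answers A Q) ∧
    ∃ bs, Invariant (ranking A) (Q.map (queryRank A)) bs ∧
      (onlineAlg.{u} n).totalCost A Q ≤
        n + potential bs + searchCount Q * (Nat.log 2 n + 3) := by
  obtain ⟨h1, h2, h3⟩ := (exists_init n).choose_spec (ranking A)
  rw [← (tieBreak_spec A (exists_init n).choose).1] at h1 h2
  rw [← (tieBreak_spec A (exists_init n).choose).2] at h3
  obtain ⟨h4, bs, h5, h6⟩ := onlineAlg_run A (Q.map (queryRank A)) Q _
    (fun q hq => List.mem_map_of_mem hq) (h1 _)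
  refine ⟨h4, bs, h5, ?_⟩
  exact (Nat.add_le_add h3 ((Nat.le_add_right _ _).trans h6)).trans (by omega)

end Algorithm

end Multiselection

/-! ### Gaps and distances to the cuts -/

namespace Multiselection

section Gaps

/-- The gaps of a sorted list of ranks above `a`. -/
def gapsFrom (n a : ℕ) (L : List ℕ) : List ℕ :=
  List.zipWith (fun a b => b - a) (a :: L) (L ++ [n])

/-- The product of the factorials of the gaps. -/
def gapProd (n : ℕ) (S : List ℕ) : ℕ := ((gaps n S).map Nat.factorial).prod

theorem gapsFrom_nil (n a : ℕ) : gapsFrom n a [] = [n - a] := rfl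

theorem gapsFrom_cons (n a b : ℕ) (L : List ℕ) :
    gapsFrom n a (b :: L) = (b - a) :: gapsFrom n b L := rfl

theorem gaps_eq_gapsFrom (n : ℕ) (S : List ℕ) :
    gaps n S = gapsFrom n 0 (S.insertionSort (· ≤ ·)) := rfl

theorem gapProd_pos (n : ℕ) (S : List ℕ) : 0 < gapProd n S := by
  refine Nat.pos_of_ne_zero (List.prod_ne_zero ?_)
  simp [Nat.factorial_ne_zero]

theorem infoBound_eq (n : ℕ) (S : List ℕ) :
    infoBound n S = Real.logb 2 (n.factorial : ℝ) - Real.logb 2 (gapProd n S : ℝ) := by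
  rw [infoBound, gapProd]
  congr 1
  induction gaps n S with
  | nil => simp
  | cons d l ih =>
    rw [List.map_cons, List.sum_cons, List.map_cons, List.prod_cons, Nat.cast_mul, Real.logb_mul, ih]
    · exact_mod_cast Nat.factorial_ne_zero d
    · have : (l.map Nat.factorial).prod ≠ 0 :=
        List.prod_ne_zero (by simp [Nat.factorial_ne_zero])
      exact_mod_cast this

theorem sorted_cons_insertionSort (S : List ℕ) :
    (0 :: S.insertionSort (· ≤ ·)).Pairwise (· ≤ ·) :=
  List.pairwise_cons.2 ⟨fun _ _ => Nat.zero_le _, List.pairwise_insertionSort _ _⟩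

theorem insertionSort_le {n : ℕ} {S : List ℕ} (hS : ∀ s ∈ S, s ≤ n) :
    ∀ s ∈ 0 :: S.insertionSort (· ≤ ·), s ≤ n := by
  intro s hs
  rcases List.mem_cons.1 hs with rfl | hs
  · exact Nat.zero_le _
  · exact hS s ((List.mem_insertionSort _).1 hs)

/-- Multinomial coefficients are at least 1. -/
theorem prod_factorial_gapsFrom_le {n : ℕ} {L : List ℕ} : ∀ {a : ℕ}, (a :: L).Pairwise (· ≤ ·) →
    (∀ s ∈ a :: L, s ≤ n) → ((gapsFrom n a L).map Nat.factorial).prod ≤ (n - a).factorial := by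
  induction L with
  | nil => intro a _ _; simp [gapsFrom_nil]
  | cons b L ih =>
    intro a hL hn
    have hab : a ≤ b := (List.pairwise_cons.1 hL).1 b (by simp)
    have hbn : b ≤ n := hn b (by simp)
    rw [gapsFrom_cons, List.map_cons, List.prod_cons]
    refine (Nat.mul_le_mul_left _ (ih (List.pairwise_cons.1 hL).2
      fun s hs => hn s (List.mem_cons_of_mem _ hs))).trans ?_
    have := Nat.le_of_dvd (Nat.factorial_pos _)
      (Nat.factorial_mul_factorial_dvd_factorial_add (b - a) (n - b))
    rwa [show b - a + (n - b) = n - a by omega] at this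

theorem infoBound_nonneg {n : ℕ} {S : List ℕ} (hS : ∀ s ∈ S, s ≤ n) : 0 ≤ infoBound n S := by
  rw [infoBound_eq, sub_nonneg]
  refine Real.logb_le_logb_of_le (by norm_num) (by exact_mod_cast gapProd_pos n S) ?_
  exact_mod_cast prod_factorial_gapsFrom_le (sorted_cons_insertionSort S) (insertionSort_le hS)

/-- A crude form of Stirling's formula; the induction step uses (1 + 1/(d+1))^(d+1) ≤ e < 4. -/
theorem succ_pow_le (d : ℕ) : (d + 1) ^ d ≤ 4 ^ d * d.factorial := by
  induction d with
  | zero => simp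
  | succ d ih =>
    have h : ((d : ℝ) + 2) ^ (d + 1) ≤ 4 * ((d : ℝ) + 1) ^ (d + 1) := by
      have h1 : ((d : ℝ) + 2) = (1 / ((d : ℝ) + 1) + 1) * (d + 1) := by
        field_simp
        ring
      have h2 : (1 / ((d : ℝ) + 1) + 1) ^ (d + 1) ≤ 4 := by
        calc (1 / ((d : ℝ) + 1) + 1) ^ (d + 1) ≤ (Real.exp (1 / ((d : ℝ) + 1))) ^ (d + 1) := by
              gcongr; exact Real.add_one_le_exp _
          _ = Real.exp 1 := by
              rw [← Real.exp_nat_mul]; congr 1; push_cast; field_simp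
          _ ≤ 4 := by have := Real.exp_one_lt_d9; linarith
      rw [h1, mul_pow]
      gcongr
    have h' : (d + 2) ^ (d + 1) ≤ 4 * (d + 1) ^ (d + 1) := by exact_mod_cast h
    calc (d + 1 + 1) ^ (d + 1) ≤ 4 * (d + 1) ^ (d + 1) := h'
      _ = 4 * (d + 1) * (d + 1) ^ d := by ring
      _ ≤ 4 * (d + 1) * (4 ^ d * d.factorial) := Nat.mul_le_mul_left _ ih
      _ = 4 ^ (d + 1) * (d + 1).factorial := by rw [Nat.factorial_succ]; ring

/-- With d = b - a, the point at offset i has distances i + 1 and d - i to the ends. One of them is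
at most δ and the other at most d + 1, so (i+1)(d-i) ≤ δ (d+1). Multiplying over i gives (d!)² ≤
(d+1)^d ∏ δ, and `succ_pow_le` allows one factor d! to be cancelled. -/
theorem factorial_le_prod_dist {a b : ℕ} (δ : ℕ → ℕ)
    (hδ : ∀ v, a ≤ v → v < b → v - a + 1 ≤ δ v ∨ b - v ≤ δ v) :
    (b - a).factorial ≤ 4 ^ (b - a) * ∏ v ∈ Finset.Ico a b, δ v := by
  obtain ⟨d, hd⟩ : ∃ d, d = b - a := ⟨_, rfl⟩
  rw [Finset.prod_Ico_eq_prod_range, ← hd]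
  have h1 : ∏ i ∈ Finset.range d, ((i + 1) * (d - i)) ≤
      ∏ i ∈ Finset.range d, (δ (a + i) * (d + 1)) := by
    refine Finset.prod_le_prod' fun i hi => ?_
    have hi' := Finset.mem_range.1 hi
    rcases hδ (a + i) (by omega) (by omega) with h | h
    · exact Nat.mul_le_mul (by omega) (by omega)
    · rw [mul_comm]
      exact Nat.mul_le_mul (by omega) (by omega)
  have h2 : ∏ i ∈ Finset.range d, (d - i) = d.factorial := by
    rw [← Finset.prod_range_add_one_eq_factorial,
      ← Finset.prod_range_reflect (fun i => i + 1)]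
    refine Finset.prod_congr rfl fun i hi => ?_
    have := Finset.mem_range.1 hi
    omega
  rw [Finset.prod_mul_distrib, Finset.prod_mul_distrib, h2,
    Finset.prod_range_add_one_eq_factorial, Finset.prod_const, Finset.card_range] at h1
  have h3 := h1.trans (Nat.mul_le_mul_left _ (succ_pow_le d))
  refine Nat.le_of_mul_le_mul_right (a := d.factorial) ?_ (Nat.factorial_pos d)
  calc _ ≤ _ := h3
    _ = _ := by ring

/-- The end points count as cuts so that the induction closes: left of the first cut `b` all other
cuts and `n` are at least as far away as `b`, and right of `b` it takes over the role of `a`. -/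
theorem prod_factorial_gapsFrom_le_prod_dist {n : ℕ} (δ : ℕ → ℕ) {L : List ℕ} : ∀ {a : ℕ},
    (a :: L).Pairwise (· ≤ ·) → (∀ s ∈ a :: L, s ≤ n) →
    (∀ v, a ≤ v → v < n → v - a + 1 ≤ δ v ∨ n - v ≤ δ v ∨ ∃ s ∈ L, cutDist v s ≤ δ v) →
    ((gapsFrom n a L).map Nat.factorial).prod ≤ 4 ^ (n - a) * ∏ v ∈ Finset.Ico a n, δ v := by
  induction L with
  | nil =>
    intro a _ _ hδ
    simp only [gapsFrom_nil, List.map_cons, List.map_nil, List.prod_singleton]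
    refine factorial_le_prod_dist δ fun v h1 h2 => ?_
    simpa using hδ v h1 h2
  | cons b L ih =>
    intro a hL hn hδ
    have hL' := List.pairwise_cons.1 hL
    have hab : a ≤ b := hL'.1 b (by simp)
    have hbn : b ≤ n := hn b (by simp)
    have hbL := (List.pairwise_cons.1 hL'.2).1
    rw [gapsFrom_cons, List.map_cons, List.prod_cons]
    have h1 := factorial_le_prod_dist (a := a) (b := b) δ fun v hv1 hv2 => by
      rcases hδ v hv1 (by omega) with h | h | ⟨s, hs, h⟩
      · exact Or.inl h
      · right; omega
      · right
        have hbs : b ≤ s := by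
          rcases List.mem_cons.1 hs with rfl | hs
          exacts [le_rfl, hbL s hs]
        rw [cutDist, if_neg (by omega)] at h
        omega
    have h2 := ih hL'.2 (fun s hs => hn s (List.mem_cons_of_mem _ hs)) fun v hv1 hv2 => by
      rcases hδ v (by omega) hv2 with h | h | ⟨s, hs, h⟩
      · left; omega
      · exact Or.inr (Or.inl h)
      · rcases List.mem_cons.1 hs with rfl | hs
        · left
          rwa [cutDist, if_pos hv1] at h
        · exact Or.inr (Or.inr ⟨s, hs, h⟩)
    calc _ ≤ _ := Nat.mul_le_mul h1 h2
      _ = 4 ^ (b - a + (n - b)) *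
          ((∏ v ∈ Finset.Ico a b, δ v) * ∏ v ∈ Finset.Ico b n, δ v) := by rw [pow_add]; ring
      _ = _ := by
        rw [Finset.prod_Ico_consecutive δ hab hbn, show b - a + (n - b) = n - a by omega]

theorem gapProd_le_prod_dist {n : ℕ} (δ : ℕ → ℕ) {S : List ℕ} (hS : ∀ s ∈ S, s ≤ n)
    (hδ : ∀ v < n, ∃ s ∈ S, cutDist v s ≤ δ v) :
    gapProd n S ≤ 4 ^ n * ∏ v ∈ Finset.range n, δ v := by
  rw [Finset.range_eq_Ico]
  refine prod_factorial_gapsFrom_le_prod_dist δ (sorted_cons_insertionSort S)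
    (insertionSort_le hS) fun v _ hv => ?_
  obtain ⟨s, hs, h⟩ := hδ v hv
  exact Or.inr (Or.inr ⟨s, (List.mem_insertionSort _).2 hs, h⟩)

end Gaps

/-! ### The upper bound -/

section Analysis

theorem sq_le_depth (t : ℕ) : t ^ 2 ≤ 2 * depth t := by
  induction t with
  | zero => simp
  | succ t ih => rw [depth]; nlinarith

/-- The weight is depth t + 217 (t + 1), and t ≤ 2√l because depth t is at least t²/2. -/
theorem weight_succ_le (t : ℕ) {l : ℝ} (hl : (depth t : ℝ) ≤ l) :
    (weight (t + 1) : ℝ) ≤ l + 434 * √l + 217 := by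
  have h1 : (t : ℝ) ≤ 2 * √l := by
    have h2 : (t : ℝ) ^ 2 ≤ 2 * depth t := by exact_mod_cast sq_le_depth t
    have h0 : (0 : ℝ) ≤ l := (Nat.cast_nonneg _).trans hl
    refine le_of_sq_le_sq ?_ (by positivity)
    rw [mul_pow, Real.sq_sqrt h0]
    linarith
  simp only [weight, depth]
  push_cast
  linarith

/-- The blocks are disjoint, so the potential can be distributed over the elements. -/
theorem IsLayout.exists_lev {ι : Type} [DecidableEq ι] {v : ι → ℕ} {bs : List (Block ι)} :
    ∀ {X : Finset ι}, IsLayout v bs X → ∃ f : ι → ℕ,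
      ∑ x ∈ X, weight (f x) = potential bs ∧ ∀ x ∈ X, ∃ b ∈ bs, x ∈ b.els ∧ f x = b.lev := by
  induction bs with
  | nil =>
    intro X h
    have : X = ∅ := by ext x; simp [h.mem_iff]
    exact ⟨fun _ => 0, by simp [this, potential], by simp [this]⟩
  | cons b bs ih =>
    intro X h
    obtain ⟨B, Q, rfl, hB, hQ, hBQ⟩ := IsLayout.of_append (bs := [b]) h
    obtain rfl := hB.of_singleton
    have hdis : Disjoint b.els Q := Finset.disjoint_left.2 fun x hx hx' => (hBQ x hx x hx').false
    obtain ⟨f, hf1, hf2⟩ := ih hQ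
    refine ⟨fun x => if x ∈ b.els then b.lev else f x, ?_, ?_⟩
    · rw [Finset.sum_union hdis, potential_cons, ← hf1]
      congr 1
      · rw [← smul_eq_mul, ← Finset.sum_const]
        exact Finset.sum_congr rfl fun x hx => congrArg weight (if_pos hx)
      · exact Finset.sum_congr rfl fun x hx =>
          congrArg weight (if_neg (Finset.disjoint_right.1 hdis hx))
    · intro x hx
      by_cases hxb : x ∈ b.els
      · exact ⟨b, by simp, hxb, by simp [hxb]⟩
      · obtain ⟨c, hc, hxc, hfx⟩ := hf2 x ((Finset.mem_union.1 hx).resolve_left hxb)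
        exact ⟨c, by simp [hc], hxc, by simp [hxb, hfx]⟩

theorem cutDist_pos (a s : ℕ) : 0 < cutDist a s := by
  unfold cutDist; split_ifs <;> omega

/-- Every element pays for its distance from the nearest requested rank. -/
theorem Invariant.exists_dist {n : ℕ} {e : Equiv.Perm (Fin n)} {S : List ℕ}
    {bs : List (Block (Fin n))} (h : Invariant e S bs) (hS : ∀ s ∈ S, s ≤ n) (hne : S ≠ []) :
    ∃ δ : ℕ → ℕ, (∀ a < n, 0 < δ a ∧ δ a ≤ n ∧ ∃ s ∈ S, cutDist a s ≤ δ a) ∧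
      (potential bs : ℝ) ≤ ∑ a ∈ Finset.range n, (Real.logb 2 (n / δ a) +
        434 * √(Real.logb 2 (n / δ a)) + 217) := by
  obtain ⟨f, hf1, hf2⟩ := h.layout.exists_lev
  have key : ∀ a : Fin n, ∃ d : ℕ, 0 < d ∧ d ≤ n ∧ (∃ s ∈ S, cutDist a s ≤ d) ∧
      (weight (f (e.symm a)) : ℝ) ≤ Real.logb 2 (n / d) + 434 * √(Real.logb 2 (n / d)) + 217 := by
    intro a
    obtain ⟨b, hb, hab, hfb⟩ := hf2 (e.symm a) (Finset.mem_univ _)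
    rcases hlev : b.lev with _ | t
    -- An element of level 0 has paid nothing; δ = n is admissible, since every cut is within
    -- distance n.
    · obtain ⟨s, hs⟩ := List.exists_mem_of_ne_nil S hne
      have hn : 0 < n := a.pos
      refine ⟨n, hn, le_rfl, ⟨s, hs, ?_⟩, ?_⟩
      · have := hS s hs
        have := a.2
        unfold cutDist
        split_ifs <;> omega
      · rw [hfb, hlev, div_self (by positivity)]
        simp [weight, depth]
    · obtain ⟨s, hs, hd⟩ := h.close b hb t hlev _ hab
      simp only [rankFun, Equiv.apply_symm_apply] at hd
      have hpos := cutDist_pos (a : ℕ) s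
      refine ⟨cutDist a s, hpos, (Nat.le_mul_of_pos_right _ (by positivity)).trans hd,
        ⟨s, hs, le_rfl⟩, ?_⟩
      rw [hfb, hlev]
      refine weight_succ_le t ?_
      rw [Real.le_logb_iff_rpow_le (by norm_num) (div_pos (by exact_mod_cast a.pos)
        (by exact_mod_cast hpos)), Real.rpow_natCast, le_div_iff₀ (by exact_mod_cast hpos), mul_comm]
      exact_mod_cast hd
  choose d hd1 hd2 hd3 hd4 using key
  refine ⟨fun a => if ha : a < n then d ⟨a, ha⟩ else 0, fun a ha => ?_, ?_⟩
  · simp only [dif_pos ha]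
    exact ⟨hd1 _, hd2 _, hd3 ⟨a, ha⟩⟩
  · rw [Finset.sum_range]
    simp only [Fin.is_lt, dif_pos, Fin.eta]
    rw [← hf1, ← Equiv.sum_comp e.symm (fun x => weight (f x))]
    push_cast
    exact Finset.sum_le_sum fun a _ => hd4 a

/-- The sum is n log₂ n - log₂ ∏ δ. Replacing n^n by n! and ∏ δ by the product of the Δᵢ! costs a
factor 4^n each, that is, 2n twice. -/
theorem sum_logb_dist_le {n : ℕ} {S : List ℕ} (hS : ∀ s ∈ S, s ≤ n) (hn : 0 < n) {δ : ℕ → ℕ}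
    (hδ : ∀ a < n, 0 < δ a ∧ δ a ≤ n ∧ ∃ s ∈ S, cutDist a s ≤ δ a) :
    ∑ a ∈ Finset.range n, Real.logb 2 (n / δ a) ≤ infoBound n S + 4 * n := by
  have hn' : (0 : ℝ) < n := by exact_mod_cast hn
  have hpos : ∀ a ∈ Finset.range n, (δ a : ℝ) ≠ 0 := fun a ha => by
    have := (hδ a (Finset.mem_range.1 ha)).1
    positivity
  have h1 : ∑ a ∈ Finset.range n, Real.logb 2 (n / δ a) =
      n * Real.logb 2 n - Real.logb 2 (∏ a ∈ Finset.range n, (δ a : ℝ)) := by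
    rw [Real.logb_prod _ _ hpos, Finset.sum_congr rfl fun a ha =>
      Real.logb_div hn'.ne' (hpos a ha), Finset.sum_sub_distrib, Finset.sum_const,
      Finset.card_range, nsmul_eq_mul]
  have h4 : Real.logb 2 ((4 : ℝ) ^ n) = 2 * n := by
    rw [Real.logb_pow, show (4 : ℝ) = 2 ^ 2 by norm_num, Real.logb_pow, Real.logb_self_eq_one
      (by norm_num)]
    push_cast; ring
  have h2 : (n : ℝ) * Real.logb 2 n ≤ 2 * n + Real.logb 2 (n.factorial : ℝ) := by
    rw [← Real.logb_pow, ← h4, ← Real.logb_mul (by positivity) (by positivity)]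
    refine Real.logb_le_logb_of_le (by norm_num) (by positivity) ?_
    have : n ^ n ≤ 4 ^ n * n.factorial :=
      (Nat.pow_le_pow_left (Nat.le_succ n) n).trans (succ_pow_le n)
    exact_mod_cast this
  have h3 : Real.logb 2 (gapProd n S : ℝ) ≤
      2 * n + Real.logb 2 (∏ a ∈ Finset.range n, (δ a : ℝ)) := by
    rw [← h4, ← Real.logb_mul (by positivity) (Finset.prod_ne_zero_iff.2 hpos)]
    refine Real.logb_le_logb_of_le (by norm_num) (by exact_mod_cast gapProd_pos n S) ?_
    exact_mod_cast gapProd_le_prod_dist δ hS fun v hv => (hδ v hv).2.2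
  rw [h1, infoBound_eq]
  linarith

/-- Cauchy–Schwarz bounds the sum of the roots by √(n (𝓑 + 4n)) ≤ √(n𝓑) + 2n. The linear term is 4 +
2 · 434 + 217 = 1089. -/
theorem Invariant.potential_le {n : ℕ} {e : Equiv.Perm (Fin n)} {S : List ℕ}
    {bs : List (Block (Fin n))} (h : Invariant e S bs) (hS : ∀ s ∈ S, s ≤ n) (hn : 0 < n) :
    (potential bs : ℝ) ≤ infoBound n S + 434 * √(n * infoBound n S) + 1089 * n := by
  have hB := infoBound_nonneg hS
  have hn' : (0 : ℝ) < n := by exact_mod_cast hn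
  -- Without queries no block can have been split.
  rcases eq_or_ne S [] with rfl | hne
  · have : potential bs = 0 := by
      rw [potential, List.sum_eq_zero_iff]
      simp only [List.mem_map]
      rintro _ ⟨b, hb, rfl⟩
      rcases hlev : b.lev with _ | t
      · simp [weight, depth]
      · obtain ⟨s, hs, -⟩ := h.close b hb t hlev _ (h.layout.top_mem b hb)
        simp at hs
    rw [this]
    push_cast
    positivity
  · obtain ⟨δ, hδ, hpot⟩ := h.exists_dist hS hne
    have hsum := sum_logb_dist_le hS hn hδ
    have hnn : ∀ a ∈ Finset.range n, 0 ≤ Real.logb 2 (n / δ a) := fun a ha => by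
      obtain ⟨h1, h2, -⟩ := hδ a (Finset.mem_range.1 ha)
      refine Real.logb_nonneg (by norm_num) ?_
      rw [one_le_div (by exact_mod_cast h1)]
      exact_mod_cast h2
    rw [Finset.sum_add_distrib, Finset.sum_add_distrib, ← Finset.mul_sum, Finset.sum_const,
      Finset.card_range, nsmul_eq_mul] at hpot
    have hsqrt : ∑ a ∈ Finset.range n, √(Real.logb 2 (n / δ a)) ≤
        √(n * infoBound n S) + 2 * n := by
      refine le_of_sq_le_sq ?_ (by positivity)
      have h1 := sq_sum_le_card_mul_sum_sq (s := Finset.range n)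
        (f := fun a => √(Real.logb 2 (n / δ a)))
      rw [Finset.card_range, Finset.sum_congr rfl fun a ha => Real.sq_sqrt (hnn a ha)] at h1
      refine h1.trans ((mul_le_mul_of_nonneg_left hsum hn'.le).trans ?_)
      have h2 := Real.sq_sqrt (mul_nonneg hn'.le hB)
      have h3 : 0 ≤ √(n * infoBound n S) * n := by positivity
      nlinarith
    linarith

/-- The `o(1)` term. -/
noncomputable def overhead (x : ℝ) : ℝ := min 1 (434 / √x)

theorem overhead_nonneg (x : ℝ) : 0 ≤ overhead x := le_min zero_le_one (by positivity)

theorem overhead_le_one (x : ℝ) : overhead x ≤ 1 := min_le_left _ _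

theorem tendsto_overhead : Filter.Tendsto overhead Filter.atTop (nhds 0) := by
  have h : Filter.Tendsto (fun x : ℝ => 434 / √x) Filter.atTop (nhds 0) :=
    Real.tendsto_sqrt_atTop.const_div_atTop 434
  refine squeeze_zero overhead_nonneg (fun x => min_le_right _ _) h

/-- If √(B/n) exceeds 434, the left side equals B · `overhead` (B/n); otherwise it is at most 434² n
= 188356 n. -/
theorem sqrt_mul_le_overhead {n B : ℝ} (hn : 0 < n) (hB : 0 ≤ B) :
    434 * √(n * B) ≤ B * overhead (B / n) + 188356 * n := by
  obtain ⟨y, hy⟩ : ∃ y, y = √(B / n) := ⟨_, rfl⟩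
  have hy0 : 0 ≤ y := hy ▸ Real.sqrt_nonneg _
  have hBy : B = n * y ^ 2 := by
    rw [hy, Real.sq_sqrt (div_nonneg hB hn.le)]
    field_simp
  have hs : √(n * B) = n * y := by
    rw [hBy, show n * (n * y ^ 2) = (n * y) ^ 2 by ring, Real.sqrt_sq (by positivity)]
  rw [hs, overhead, ← hy, hBy]
  rcases le_or_gt y 434 with h | h
  · have h1 : 0 ≤ n * y ^ 2 * min 1 (434 / y) :=
      mul_nonneg (by positivity) (le_min zero_le_one (by positivity))
    nlinarith
  · rw [min_eq_right ((div_le_one (by linarith)).2 h.le)]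
    have : n * y ^ 2 * (434 / y) = 434 * (n * y) := by
      field_simp
    rw [this]
    nlinarith

theorem queryRank_le {n : ℕ} {α : Type*} [LinearOrder α] (A : Fin n → α) (q : Query n α) :
    queryRank A q ≤ n := by
  cases q with
  | select s => exact s.2
  | search p =>
    simp only [queryRank, searchPosition]
    split_ifs with h
    · obtain ⟨i, hi⟩ := h
      have : (Finset.univ.filter fun i => A i < p) ⊂ Finset.univ :=
        Finset.filter_ssubset.2 ⟨i, Finset.mem_univ i, by simp [hi]⟩
      simpa using Finset.card_lt_card this
    · simpa using Finset.card_le_univ (Finset.univ.filter fun i => A i < p)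

/-- The constant 190000 covers 1 for preprocessing, 1089 and 188356; for searches, ⌊log₂ n⌋ + 3 ≤ 4
log₂ n would do. -/
theorem onlineAlg_totalCost_le {n : ℕ} (hn : 2 ≤ n) {α : Type u} [LinearOrder α] (A : Fin n → α)
    (Q : List (Query n α)) :
    ((onlineAlg.{u} n).totalCost A Q : ℝ) ≤
      infoBound n (Q.map (queryRank A)) *
          (1 + overhead (infoBound n (Q.map (queryRank A)) / n)) +
        190000 * (n + searchCount Q * Real.logb 2 n) := by
  obtain ⟨-, bs, hI, hcost⟩ := onlineAlg_spec A Q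
  have hS : ∀ s ∈ Q.map (queryRank A), s ≤ n := by
    intro s hs
    obtain ⟨q, -, rfl⟩ := List.mem_map.1 hs
    exact queryRank_le A q
  have hn0 : (0 : ℝ) < n := by positivity
  have hpot := hI.potential_le hS (by omega)
  have hov := sqrt_mul_le_overhead hn0 (infoBound_nonneg hS)
  have hlog : ((Nat.log 2 n : ℕ) : ℝ) ≤ Real.logb 2 n := by exact_mod_cast Real.natLog_le_logb n 2
  have hlog1 : 1 ≤ Real.logb 2 n := by
    rw [Real.le_logb_iff_rpow_le (by norm_num) hn0, Real.rpow_one]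
    exact_mod_cast hn
  have hcost' : ((onlineAlg.{u} n).totalCost A Q : ℝ) ≤
      n + potential bs + searchCount Q * (Nat.log 2 n + 3) := by exact_mod_cast hcost
  have hq : (searchCount Q : ℝ) * (Nat.log 2 n + 3) ≤
      190000 * (searchCount Q * Real.logb 2 n) := by
    have h0 : (0 : ℝ) ≤ searchCount Q := Nat.cast_nonneg _
    calc (searchCount Q : ℝ) * (Nat.log 2 n + 3) ≤ searchCount Q * (190000 * Real.logb 2 n) := by
          gcongr; linarith
      _ = _ := by ring
  linarith

end Analysis

end Multiselection

/-! ### Traces of comparison trees -/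

namespace Multiselection

open CompTree

section Trace

variable {ι β : Type} {α : Type*} [LinearOrder α]

/-- The outcomes of the comparisons that the procedure performs. -/
def CompTree.trace (v : ι → α) : CompTree ι β → List Bool
  | done _ => []
  | cmp x y t e => if v x ≤ v y then true :: t.trace v else false :: e.trace v

theorem CompTree.output_eq_of_trace_eq {v w : ι → α} {T : CompTree ι β}
    (h : T.trace v = T.trace w) : T.output v = T.output w := by
  induction T with
  | done b => rfl
  | cmp x y t e iht ihe =>
    simp only [trace, output] at h ⊢
    split_ifs at h ⊢ <;> simp_all

/-- If the outcomes are the same on two arrays, then they are the same on every array that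
satisfies all inequalities common to the two. -/
theorem CompTree.trace_eq_of_common_order {v w z : ι → α} (hz : Function.Injective z)
    {T : CompTree ι β} (h : T.trace v = T.trace w)
    (hvw : ∀ x y, v x ≤ v y → w x ≤ w y → z x ≤ z y) : T.trace z = T.trace v := by
  induction T with
  | done b => rfl
  | cmp x y t e iht ihe =>
    simp only [trace] at h ⊢
    by_cases h1 : v x ≤ v y <;> by_cases h2 : w x ≤ w y
    · rw [if_pos h1, if_pos h2] at h
      rw [if_pos h1, if_pos (hvw x y h1 h2), iht (List.cons.inj h).2]
    · rw [if_pos h1, if_neg h2] at h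
      simp at h
    · rw [if_neg h1, if_pos h2] at h
      simp at h
    · rw [if_neg h1, if_neg h2] at h
      have h3 : ¬ z x ≤ z y := by
        intro hc
        have h4 := hz (le_antisymm hc (hvw y x (not_le.1 h1).le (not_le.1 h2).le))
        exact h1 (h4 ▸ le_rfl)
      rw [if_neg h1, if_neg h3, ihe (List.cons.inj h).2]

/-- Only branches reached by the given family count: the tree may have others that are longer than
W. -/
theorem CompTree.card_image_trace_le {κ : Type} (v : κ → ι → α) (T : CompTree ι β) :
    ∀ (F : Finset κ) (W : ℕ), (∀ k ∈ F, T.cost (v k) ≤ W) →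
      (F.image fun k => T.trace (v k)).card ≤ 2 ^ W := by
  induction T with
  | done b =>
    intro F W _
    refine le_trans ?_ Nat.one_le_two_pow
    refine Finset.card_le_one.2 fun a ha c hc => ?_
    obtain ⟨_, _, rfl⟩ := Finset.mem_image.1 ha
    obtain ⟨_, _, rfl⟩ := Finset.mem_image.1 hc
    rfl
  | cmp x y t e iht ihe =>
    intro F W hF
    rcases F.eq_empty_or_nonempty with rfl | ⟨k₀, hk₀⟩
    · simp
    have hW : 1 ≤ W := le_trans (by simp [cost]) (hF k₀ hk₀)
    obtain ⟨W, rfl⟩ := Nat.exists_eq_add_of_le' hW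
    have h1 := iht (F.filter fun k => v k x ≤ v k y) W fun k hk => by
      obtain ⟨hk, hk'⟩ := Finset.mem_filter.1 hk
      have := hF k hk
      simp only [cost, if_pos hk'] at this
      omega
    have h2 := ihe (F.filter fun k => ¬ v k x ≤ v k y) W fun k hk => by
      obtain ⟨hk, hk'⟩ := Finset.mem_filter.1 hk
      have := hF k hk
      simp only [cost, if_neg hk'] at this
      omega
    have hsub : (F.image fun k => (cmp x y t e).trace (v k)) ⊆
        ((F.filter fun k => v k x ≤ v k y).image fun k => t.trace (v k)).image (List.cons true) ∪
        ((F.filter fun k => ¬ v k x ≤ v k y).image fun k => e.trace (v k)).image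
          (List.cons false) := by
      intro l hl
      obtain ⟨k, hk, rfl⟩ := Finset.mem_image.1 hl
      rw [Finset.mem_union]
      by_cases hxy : v k x ≤ v k y
      · left
        simp only [trace, if_pos hxy]
        exact Finset.mem_image_of_mem _ (Finset.mem_image_of_mem (fun k => t.trace (v k))
          (Finset.mem_filter.2 ⟨hk, hxy⟩))
      · right
        simp only [trace, if_neg hxy]
        exact Finset.mem_image_of_mem _ (Finset.mem_image_of_mem (fun k => e.trace (v k))
          (Finset.mem_filter.2 ⟨hk, hxy⟩))
    refine (Finset.card_le_card hsub).trans ((Finset.card_union_le _ _).trans ?_)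
    rw [pow_succ, mul_two]
    exact Nat.add_le_add (Finset.card_image_le.trans h1) (Finset.card_image_le.trans h2)

end Trace

/-! ### The lower bound for offline algorithms -/

section LowerBound

variable {n : ℕ}

theorem card_filter_le_sorted {A : Fin n → ℕ} (hA : Function.Injective A) {s i : Fin n}
    (h : A i = sorted A s) : (Finset.univ.filter fun y => A y ≤ A i).card = s + 1 := by
  have hi : i = Tuple.sort A s := hA h
  have hr : rankFun (ranking A) i = s := by rw [hi]; simp [rankFun, ranking]
  rw [← hr, ← card_filter_rankFun_le]
  congr 1
  ext y
  simp only [Finset.mem_filter, Finset.mem_univ, true_and]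
  refine ⟨fun h => ?_, fun h => le_of_ranking_le (Fin.le_def.2 h)⟩
  rcases h.lt_or_eq with h | h
  · exact (Fin.lt_def.1 (ranking_lt_of_lt h)).le
  · rw [hA h]

/-- The elements of rank at most `s` are determined by the outcomes of the comparisons. -/
theorem SolvesOffline.le_iff_of_trace_eq {S : List (Fin n)} {T : CompTree (Fin n) (List (Fin n))}
    (hT : SolvesOffline S T) {e e' : Equiv.Perm (Fin n)}
    (h : T.trace (rankFun e) = T.trace (rankFun e')) {s : Fin n} (hs : s ∈ S) (y : Fin n) :
    e y ≤ s ↔ e' y ≤ s := by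
  obtain ⟨k, hk, rfl⟩ := List.getElem_of_mem hs
  have hget : ∀ A : Fin n → ℕ, Function.Injective A → ∀ o, T.output A = o →
      ∃ hk' : k < o.length, A o[k] = sorted A S[k] := by
    rintro A hA _ rfl
    obtain ⟨hl, hall⟩ := List.forall₂_iff_get.1 (hT A hA)
    exact ⟨hl ▸ hk, hall k hk (hl ▸ hk)⟩
  obtain ⟨o, ho⟩ : ∃ o, T.output (rankFun e) = o := ⟨_, rfl⟩
  have ho' : T.output (rankFun e') = o := (output_eq_of_trace_eq h).symm.trans ho
  obtain ⟨hk', h1⟩ := hget _ (rankFun_injective e) o ho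
  obtain ⟨_, h2⟩ := hget _ (rankFun_injective e') o ho'
  set i := o[k] with hi
  set D := Finset.univ.filter fun y => rankFun e y ≤ rankFun e i ∧ rankFun e' y ≤ rankFun e' i
    with hD
  have hmemD : ∀ y, y ∈ D ↔ rankFun e y ≤ rankFun e i ∧ rankFun e' y ≤ rankFun e' i := by
    simp [hD]
  -- `z` is the order of `e` with `D` moved to the front. As `D` is closed downwards under the
  -- inequalities common to `e` and `e'`, `z` satisfies all of these, so the tree gives the same
  -- answer `i` on `z`. Correctness there forces `D` to have s + 1 elements, hence to be the full
  -- initial segment of both orders.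
  let z : Fin n → ℕ := fun y => if y ∈ D then rankFun e y else rankFun e y + n
  have hlt : ∀ y, rankFun e y < n := fun y => (e y).2
  have hz : Function.Injective z := by
    intro x y hxy
    have hx := hlt x
    have hy := hlt y
    simp only [z] at hxy
    refine rankFun_injective e ?_
    split_ifs at hxy <;> omega
  have hiD : i ∈ D := (hmemD i).2 ⟨le_rfl, le_rfl⟩
  have htz : T.trace z = T.trace (rankFun e) := by
    refine trace_eq_of_common_order hz h fun x y hx hy => ?_
    simp only [z]
    have := hlt x
    by_cases hyD : y ∈ D
    · have hxD : x ∈ D := (hmemD x).2 ⟨hx.trans ((hmemD y).1 hyD).1, hy.trans ((hmemD y).1 hyD).2⟩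
      rw [if_pos hyD, if_pos hxD]
      exact hx
    · rw [if_neg hyD]
      split_ifs <;> omega
  obtain ⟨_, h3⟩ := hget z hz o ((output_eq_of_trace_eq htz).trans ho)
  have c1 := card_filter_le_sorted (rankFun_injective e) h1
  have c2 := card_filter_le_sorted (rankFun_injective e') h2
  have c3 := card_filter_le_sorted hz h3
  have hzD : (Finset.univ.filter fun y => z y ≤ z i) = D := by
    ext y
    simp only [Finset.mem_filter, Finset.mem_univ, true_and, z, if_pos hiD]
    have := hlt i
    by_cases hyD : y ∈ D
    · simp only [hyD, if_true, iff_true]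
      exact ((hmemD y).1 hyD).1
    · simp only [hyD, if_false, iff_false]
      omega
  rw [hzD] at c3
  have e1 : D = Finset.univ.filter fun y => rankFun e y ≤ rankFun e i :=
    Finset.eq_of_subset_of_card_le (fun y hy => by
      simpa using ((hmemD y).1 hy).1) (by rw [c1, c3])
  have e2 : D = Finset.univ.filter fun y => rankFun e' y ≤ rankFun e' i :=
    Finset.eq_of_subset_of_card_le (fun y hy => by
      simpa using ((hmemD y).1 hy).2) (by rw [c2, c3])
  have r1 : rankFun e i = S[k] := by rw [card_filter_rankFun_le] at c1; omega
  have r2 : rankFun e' i = S[k] := by rw [card_filter_rankFun_le] at c2; omega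
  have m1 : y ∈ D ↔ rankFun e y ≤ rankFun e i := by rw [e1]; simp
  have m2 : y ∈ D ↔ rankFun e' y ≤ rankFun e' i := by rw [e2]; simp
  rw [r1] at m1
  rw [r2] at m2
  rw [Fin.le_def, Fin.le_def]
  exact m1.symm.trans m2

/-- The sizes of the classes into which the ranks are cut are the gaps. -/
theorem prod_factorial_card_eq {N : ℕ} {L : List ℕ} : ∀ {a : ℕ}, (a :: L).Pairwise (· ≤ ·) →
    (∀ s ∈ a :: L, s ≤ N) →
    ∏ k ∈ Finset.range (L.length + 1),
      ((Finset.Ico a N).filter fun v => L.countP (· ≤ v) = k).card.factorial =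
      ((gapsFrom N a L).map Nat.factorial).prod := by
  induction L with
  | nil => intro a _ _; simp [gapsFrom_nil]
  | cons b L ih =>
    intro a hL hn
    have hL' := List.pairwise_cons.1 hL
    have hab : a ≤ b := hL'.1 b (by simp)
    have hbn : b ≤ N := hn b (by simp)
    have hbL := (List.pairwise_cons.1 hL'.2).1
    have hsmall : ∀ v, v < b → (b :: L).countP (· ≤ v) = 0 := by
      intro v hv
      rw [List.countP_eq_zero]
      intro s hs
      have : b ≤ s := by
        rcases List.mem_cons.1 hs with rfl | hs
        exacts [le_rfl, hbL s hs]
      simp only [decide_eq_true_eq]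
      omega
    have hbig : ∀ v, b ≤ v → (b :: L).countP (· ≤ v) = L.countP (· ≤ v) + 1 := fun v hv =>
      List.countP_cons_of_pos (by simpa using hv)
    rw [List.length_cons, Finset.prod_range_succ', gapsFrom_cons, List.map_cons, List.prod_cons,
      ← ih hL'.2 fun s hs => hn s (List.mem_cons_of_mem _ hs), mul_comm]
    congr 1
    · congr 1
      rw [← Nat.card_Ico]
      congr 1
      ext v
      simp only [Finset.mem_filter, Finset.mem_Ico]
      constructor
      · rintro ⟨h1, h2⟩
        refine ⟨h1.1, ?_⟩
        by_contra hc
        rw [hbig v (by omega)] at h2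
        omega
      · rintro ⟨h1, h2⟩
        exact ⟨⟨h1, by omega⟩, hsmall v h2⟩
    · refine Finset.prod_congr rfl fun k _ => ?_
      congr 2
      ext v
      simp only [Finset.mem_filter, Finset.mem_Ico]
      constructor
      · rintro ⟨h1, h2⟩
        have hbv : b ≤ v := by
          by_contra hc
          rw [hsmall v (by omega)] at h2
          omega
        rw [hbig v hbv] at h2
        exact ⟨⟨hbv, h1.2⟩, by omega⟩
      · rintro ⟨h1, h2⟩
        exact ⟨⟨by omega, h1.2⟩, by rw [hbig v h1.1, h2]⟩

/-- The number of permutations that preserve the classes cut out by `S`. -/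
theorem card_perm_preserving {S : List ℕ} (hS : ∀ s ∈ S, s ≤ n) :
    (Finset.univ.filter fun g : Equiv.Perm (Fin n) =>
      ∀ a, S.countP (· ≤ (g a : ℕ)) = S.countP (· ≤ (a : ℕ))).card = gapProd n S := by
  set L := S.insertionSort (· ≤ ·) with hL
  have hcount : ∀ v : ℕ, S.countP (· ≤ v) = L.countP (· ≤ v) := fun v =>
    ((List.perm_insertionSort _ S).countP_eq _).symm
  -- The permutations to be counted form the stabilizer of `f`, whose order is the product of the
  -- factorials of the fibre sizes.
  let f : Fin n → Fin (L.length + 1) := fun a =>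
    ⟨L.countP (· ≤ (a : ℕ)), Nat.lt_succ_of_le List.countP_le_length⟩
  have h1 := DomMulAct.stabilizer_card f
  rw [gapProd, gaps_eq_gapsFrom, ← prod_factorial_card_eq (sorted_cons_insertionSort S)
    (insertionSort_le hS), ← hL, Finset.prod_range]
  rw [Fintype.card_subtype] at h1
  convert h1 using 2
  · ext g
    simp only [Finset.mem_filter, Finset.mem_univ, true_and, funext_iff, Function.comp_apply, f,
      Fin.mk.injEq, hcount]
  · rename_i k
    congr 1
    rw [Fintype.card_subtype]
    refine Finset.card_bij' (fun v hv => ⟨v, by simpa using (Finset.mem_filter.1 hv).1⟩)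
      (fun a _ => (a : ℕ)) ?_ ?_ ?_ ?_
    · intro v hv
      simpa [f, Fin.ext_iff] using (Finset.mem_filter.1 hv).2
    · intro a ha
      simpa [f, Fin.ext_iff] using ha
    · simp
    · simp

/-- Relative to a fixed `e`, every permutation with the same trace differs by one that preserves the
classes between cuts. Each trace thus accounts for at most `gapProd` of the n! permutations. -/
theorem SolvesOffline.factorial_le {S : List (Fin n)} {T : CompTree (Fin n) (List (Fin n))}
    {W : ℕ} (hT : SolvesOffline S T) (hW : WorstCaseAtMost T W) :
    n.factorial ≤ gapProd n (S.map fun s : Fin n => (s : ℕ) + 1) * 2 ^ W := by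
  set S' := S.map fun s : Fin n => (s : ℕ) + 1 with hS'
  have hS : ∀ s ∈ S', s ≤ n := by
    intro s hs
    obtain ⟨s, -, rfl⟩ := List.mem_map.1 hs
    exact s.2
  have hfib : ∀ τ ∈ (Finset.univ : Finset (Equiv.Perm (Fin n))).image
      (fun e => T.trace (rankFun e)),
      ((Finset.univ : Finset (Equiv.Perm (Fin n))).filter
        fun e => T.trace (rankFun e) = τ).card ≤ gapProd n S' := by
    intro τ hτ
    obtain ⟨e, -, rfl⟩ := Finset.mem_image.1 hτ
    rw [← card_perm_preserving hS]
    refine Finset.card_le_card_of_injOn (fun e' => e.symm.trans e') ?_ ?_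
    · intro e' he'
      have he := (Finset.mem_filter.1 he').2
      refine Finset.mem_coe.2 (Finset.mem_filter.2 ⟨Finset.mem_univ _, fun a => ?_⟩)
      refine List.countP_congr fun s hs => ?_
      obtain ⟨r, hr, rfl⟩ := List.mem_map.1 hs
      have := hT.le_iff_of_trace_eq he hr (e.symm a)
      rw [Equiv.apply_symm_apply, Fin.le_def, Fin.le_def] at this
      rw [decide_eq_true_iff, decide_eq_true_iff, Equiv.trans_apply]
      omega
    · intro e₁ _ e₂ _ h
      ext a
      have := congrArg (fun g : Equiv.Perm (Fin n) => g (e a)) h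
      simpa using congrArg Fin.val this
  have h1 := Finset.card_le_mul_card_image (Finset.univ : Finset (Equiv.Perm (Fin n))) _ hfib
  rw [Finset.card_univ, Fintype.card_perm, Fintype.card_fin] at h1
  refine h1.trans (Nat.mul_le_mul_left _ ?_)
  exact card_image_trace_le rankFun T Finset.univ W fun e _ => hW _ (rankFun_injective e)

/-- `𝓑(S)` bounds the worst case of every offline algorithm from below. -/
theorem SolvesOffline.infoBound_le {S : List (Fin n)} {T : CompTree (Fin n) (List (Fin n))}
    {W : ℕ} (hT : SolvesOffline S T) (hW : WorstCaseAtMost T W) :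
    infoBound n (S.map fun s : Fin n => (s : ℕ) + 1) ≤ W := by
  have h : ((n.factorial : ℕ) : ℝ) ≤
      (gapProd n (S.map fun s : Fin n => (s : ℕ) + 1) : ℝ) * 2 ^ W := by
    exact_mod_cast hT.factorial_le hW
  have hg : (0 : ℝ) < gapProd n (S.map fun s : Fin n => (s : ℕ) + 1) := by
    exact_mod_cast gapProd_pos n _
  have h2 := Real.logb_le_logb_of_le (b := 2) (by norm_num)
    (by exact_mod_cast Nat.factorial_pos n) h
  rw [Real.logb_mul hg.ne' (by positivity), Real.logb_pow, Real.logb_self_eq_one (by norm_num)] at h2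
  rw [infoBound_eq]
  linarith

end LowerBound

end Multiselection

/-! ### The main theorem -/

open Multiselection in
theorem mainTheorem1 :
    ∃ (alg : ∀ n : ℕ, OnlineAlgorithm n) (C : ℝ) (ω : ℝ → ℝ),
      -- `ω` is the `o(1)` term; it is evaluated at `𝓑(S) / n`
      (∀ x, 0 ≤ ω x ∧ ω x ≤ 1) ∧
      Filter.Tendsto ω Filter.atTop (nhds 0) ∧
      -- every query is answered correctly
      (∀ (n : ℕ) (α : Type u) [LinearOrder α] (A : Fin n → α) (Q : List (Query n α)),
        List.Forall₂ (IsCorrect A) Q ((alg n).answers A Q)) ∧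
      -- number of comparisons in the worst case
      (∀ (n : ℕ), 2 ≤ n →
        ∀ (α : Type u) [LinearOrder α] (A : Fin n → α) (Q : List (Query n α)),
          ((alg n).totalCost A Q : ℝ) ≤
            infoBound n (Q.map (queryRank A)) *
                (1 + ω (infoBound n (Q.map (queryRank A)) / n)) +
              C * (n + searchCount Q * Real.logb 2 n)) ∧
      -- `𝓑(S)` bounds every offline algorithm from below, and `alg` is 1-competitive
      (∀ (n : ℕ), 2 ≤ n →
        ∀ (S : List (Fin n)) (T : CompTree (Fin n) (List (Fin n))) (W : ℕ),
          SolvesOffline S T → WorstCaseAtMost T W →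
            infoBound n (S.map fun s : Fin n => (s : ℕ) + 1) ≤ W ∧
            ∀ (α : Type u) [LinearOrder α] (A : Fin n → α),
              ((alg n).totalCost A (S.map Query.select) : ℝ) ≤
                W * (1 + ω (infoBound n (S.map fun s : Fin n => (s : ℕ) + 1) / n)) + C * n) := by
  refine ⟨onlineAlg.{u}, 190000, overhead, fun x => ⟨overhead_nonneg x, overhead_le_one x⟩,
    tendsto_overhead, fun n α _ A Q => (onlineAlg_spec A Q).1,
    fun n hn α _ A Q => onlineAlg_totalCost_le hn A Q, fun n hn S T W hT hW => ?_⟩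
  have hB := hT.infoBound_le hW
  refine ⟨hB, fun α _ A => ?_⟩
  have h := onlineAlg_totalCost_le hn A (S.map Query.select)
  have hranks : (S.map Query.select).map (queryRank A) = S.map fun s : Fin n => (s : ℕ) + 1 := by
    rw [List.map_map]; rfl
  have hcount : searchCount (S.map Query.select : List (Query n α)) = 0 := by
    rw [searchCount, List.countP_eq_zero]
    intro q hq
    obtain ⟨s, -, rfl⟩ := List.mem_map.1 hq
    simp [Query.isSearch]
  rw [hranks, hcount] at h
  have hω := overhead_nonneg (infoBound n (S.map fun s : Fin n => (s : ℕ) + 1) / n)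
  -- Only the leading factor 𝓑 is enlarged to W; the argument of the overhead stays 𝓑/n.
  have := mul_le_mul_of_nonneg_right hB (show 0 ≤ 1 + overhead
    (infoBound n (S.map fun s : Fin n => (s : ℕ) + 1) / n) by linarith)
  simp only [Nat.cast_zero, zero_mul, add_zero] at h
  linarith
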